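/- Call a compact convex set with non-empty interior in $\mathbb{R}^n$ a convex body, and let $|\cdot|$ denote Lebesgue measure. A convex body $K\subseteq\mathbb{R}^n$ is isotropic if $|K|=1$, its barycenter is at the origin, and there is a constant $L_K>0$ such that $\int_K\langle x,\theta\rangle^2\,dx=L_K^2$ for every unit vector $\theta$; then $L_K$ is called the isotropic constant of $K$. Every convex body $K\subseteq\mathbb{R}^n$ has an isotropic image under an invertible affine map, unique up to orthogonal maps, and its isotropic constant $L_K$ is defined as that of its isotropic images. The covariogram of $K$ is $g_K(x)=|K\cap(x+K)|$, $x\in\mathbb{R}^n$, and, for $p>0$ and a log-concave function $g:\mathbb{R}^n\to[0,\infty)$ with $g(0)>0$, Ball's body is $$K_p(g)=\left\{x\in\mathbb{R}^n : \int_0^\infty p\,t^{p-1}g(tx)\,dt\ge g(0)\right\}.$$ For every integer $n\ge 1$ set $$D_n=\frac{1}{\sqrt2}\,\frac{\binom{2n}{n}^{\frac12+\frac1n}}{\binom{2n+2}{n}^{\frac12}}.$$ Then for every $n\ge1$ and every isotropic convex body $K\subseteq\mathbb{R}^n$, $$L_K\le D_n\,L_{K_{n+2}(g_K)},$$ with equality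 if and only if $K$ is a regular simplex. Moreover, $\sup_{n\ge1}D_n=\sqrt2$. -/

import Mathlib

open MeasureTheory

/-- A convex body in `ℝⁿ`: a compact convex set with non-empty interior. -/
def IsConvexBody {n : ℕ} (K : Set (EuclideanSpace ℝ (Fin n))) : Prop :=
  IsCompact K ∧ Convex ℝ K ∧ (interior K).Nonempty

/-- `K` is an isotropic convex body in `ℝⁿ` whose isotropic constant is `L`: it has volume `1`,
its barycenter is at the origin, and `∫_K ⟨x, θ⟩² dx = L²` for every unit vector `θ`. -/
structure IsIsotropicWith {n : ℕ} (K : Set (EuclideanSpace ℝ (Fin n))) (L : ℝ) : Prop where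
  convexBody : IsConvexBody K
  volume_eq_one : volume K = 1
  barycenter_eq_zero : ∫ x in K, x = 0
  pos : 0 < L
  integral_inner_sq : ∀ θ : EuclideanSpace ℝ (Fin n), ‖θ‖ = 1 →
    ∫ x in K, (inner ℝ x θ) ^ 2 = L ^ 2

/-- `K` is an isotropic convex body. -/
def IsIsotropic {n : ℕ} (K : Set (EuclideanSpace ℝ (Fin n))) : Prop :=
  ∃ L : ℝ, IsIsotropicWith K L

/-- Some image of `K` under an invertible affine map of `ℝⁿ` is an isotropic convex body with
isotropic constant `L`. -/
def HasIsotropicConstant {n : ℕ} (K : Set (EuclideanSpace ℝ (Fin n))) (L : ℝ) : Prop :=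
  ∃ A : EuclideanSpace ℝ (Fin n) ≃ᵃ[ℝ] EuclideanSpace ℝ (Fin n), IsIsotropicWith (A '' K) L

open Classical in
/-- The isotropic constant `L_K` of a convex body `K` in `ℝⁿ`, `n ≥ 1`: the isotropic constant of
its isotropic affine images (they are unique up to orthogonal maps, so that all of them have the
same one). The value is `0` if `K` has no isotropic affine image, that is, if `K` is not a
convex body. -/
noncomputable def isotropicConstant {n : ℕ} (K : Set (EuclideanSpace ℝ (Fin n))) : ℝ :=
  if h : ∃ L : ℝ, HasIsotropicConstant K L then h.choose else 0

/-- The covariogram `g_K(x) = |K ∩ (x + K)|`. -/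
noncomputable def covariogram {n : ℕ} (K : Set (EuclideanSpace ℝ (Fin n)))
    (x : EuclideanSpace ℝ (Fin n)) : ℝ :=
  volume.real (K ∩ (fun y => x + y) '' K)

/-- Ball's body `K_p(g) = {x : ∫₀^∞ p t^(p-1) g(tx) dt ≥ g(0)}` of a function `g ≥ 0`. The integral
of this non-negative function takes values in `[0, ∞]`; it is `∞` at `x = 0` when `g(0) > 0`. -/
noncomputable def ballBody {n : ℕ} (p : ℝ) (g : EuclideanSpace ℝ (Fin n) → ℝ) :
    Set (EuclideanSpace ℝ (Fin n)) :=
  {x | ENNReal.ofReal (g 0) ≤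
    ∫⁻ t : ℝ in Set.Ioi 0, ENNReal.ofReal (p * t ^ (p - 1) * g (t • x))}

/-- `K` is a regular `n`-dimensional simplex in `ℝⁿ`: the convex hull of `n + 1` affinely
independent points with equal pairwise distances. -/
def IsRegularSimplex {n : ℕ} (K : Set (EuclideanSpace ℝ (Fin n))) : Prop :=
  ∃ s : Affine.Simplex ℝ (EuclideanSpace ℝ (Fin n)) n,
    s.Equilateral ∧ K = convexHull ℝ (Set.range s.points)

/-- `D_n = (1/√2) · C(2n, n)^(1/2 + 1/n) / C(2n + 2, n)^(1/2)`, for `n ≥ 1`. -/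
noncomputable def slicingConst (n : ℕ) : ℝ :=
  1 / √2 * (((2 * n).choose n : ℝ) ^ ((1 : ℝ) / 2 + 1 / (n : ℝ)) /
    ((2 * n + 2).choose n : ℝ) ^ ((1 : ℝ) / 2))

open scoped Pointwise

/-! ### The Brunn–Minkowski inequality for compact sets -/

/-! Let g be the covariogram of the isotropic body K, and put T = K_{n+2}(g), S = K_n(g). In polar
coordinates, integrating a function homogeneous of degree d over K_{n+d}(g) amounts to integrating
it against g (`IsLogConcaveDensity.lintegral_ballBody`). For d = 0 this gives |S| = ∫ g = |K|² = 1;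
for d = 2 it gives ∫_T ⟨x,θ⟩² = ∫_K ∫_K ⟨y - z,θ⟩² = 2 L_K². Since T is a convex body (Ball's
theorem, `isConvexBody_ballBody`) and is symmetric, L_T = √2 L_K |T|^(-(1/2+1/n)), so the inequality
is an upper bound for |T|.

The bound is proved ray by ray. By Brunn–Minkowski, g^(1/n) is concave on its support, and g(0) = 1.
Compare t ↦ g(tx) with the cone (1 - t/s)₊ⁿ that has the same integral against t^(n-1): the two
graphs cross once, so the cone has the larger integral against t^(n+1) (Berwald,
`integral_le_coneProfile`). Hence an explicit dilate of T lies in S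
(`volume_ballBody_covariogram_le`), and equality of volumes forces every ray profile to be a cone.

If all profiles are cones, then K ∩ (tX + K) is a homothet of K for suitably scaled X. Applied to
differences of extreme points, this is a disjointness property in the order of the cone over K,
which makes the extreme points affinely independent (`affineIndependent_extremePoints`); so K is a
simplex. The converse is a computation in barycentric coordinates. An isotropic simplex is regular
because the isotropic position is unique up to isometries, so each affine permutation of the
vertices is an isometry.

Finally D_n² = C(2n,n)^(2/n) (n+2)/(4(2n+1)), which tends to 16/8 = 2 and never exceeds 2. -/

theorem Real.volume_add_le_of_isCompact {K L U : Set ℝ} (hK : IsCompact K) (hL : IsCompact L)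
    (hK' : K.Nonempty) (hL' : L.Nonempty) (h : ∀ x ∈ K, ∀ y ∈ L, x + y ∈ U) :
    volume K + volume L ≤ volume U := by
  have hl := hL.sInf_mem hL'
  have hk := hK.sSup_mem hK'
  set l := sInf L
  set k := sSup K
  have h1 : volume ((fun x => x + l) '' K) = volume K := by
    rw [Set.image_add_right, measure_preimage_add_right]
  have h2 : volume ((fun x => k + x) '' L) = volume L := by
    rw [Set.image_add_left, measure_preimage_add]
  -- The translates K + min L and max K + L both lie in K + L and meet only at max K + min L.
  have hd : AEDisjoint volume ((fun x => x + l) '' K) ((fun x => k + x) '' L) := by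
    refine measure_mono_null (t := {k + l}) ?_ (by simp)
    rintro z ⟨⟨x, hx, rfl⟩, ⟨y, hy, hxy⟩⟩
    have a1 : x ≤ k := le_csSup hK.bddAbove hx
    have a2 : l ≤ y := csInf_le hL.bddBelow hy
    simp only at hxy
    simp only [Set.mem_singleton_iff]
    linarith
  rw [← h1, ← h2, ← measure_union₀ ((hL.image (by fun_prop)).measurableSet.nullMeasurableSet) hd]
  apply measure_mono
  rintro z (⟨x, hx, rfl⟩ | ⟨x, hx, rfl⟩)
  · exact h _ hx _ hl
  · exact h _ hk _ hx

theorem Real.volume_add_le_of_measurableSet {S T U : Set ℝ} (hS : MeasurableSet S)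
    (hT : MeasurableSet T) (hS' : S.Nonempty) (hT' : T.Nonempty)
    (h : ∀ x ∈ S, ∀ y ∈ T, x + y ∈ U) : volume S + volume T ≤ volume U := by
  obtain ⟨s, hs⟩ := hS'
  obtain ⟨t, ht⟩ := hT'
  rw [hS.measure_eq_iSup_isCompact, hT.measure_eq_iSup_isCompact]
  have key : ∀ K ⊆ S, IsCompact K → ∀ L ⊆ T, IsCompact L → volume K + volume L ≤ volume U := by
    intro K hKS hK L hLT hL
    -- Inserting a point of each set makes the compact approximants non-empty.
    have := Real.volume_add_le_of_isCompact (hK.insert s) (hL.insert t) (U := U) (by simp) (by simp)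
      (fun x hx y hy => h x (Set.insert_subset hs hKS hx) y (Set.insert_subset ht hLT hy))
    refine le_trans ?_ this
    gcongr <;> exact Set.subset_insert _ _
  simp only [iSup_and']
  refine ENNReal.biSup_add_biSup_le' (p := fun K => K ⊆ S ∧ IsCompact K)
    (q := fun K => K ⊆ T ∧ IsCompact K) ⟨∅, by simp⟩ ⟨∅, by simp⟩ ?_
  rintro K ⟨h1, h2⟩ L ⟨h3, h4⟩
  exact key K h1 h2 L h3 h4

/-- If `f`, `g` have supremum `1` and `h` dominates the smaller of `f` and `g` along convex
combinations, then its integral dominates the convex combination of the integrals. -/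
theorem lintegral_convex_comb_le_of_min_le {f g h : ℝ → ℝ} (hf : Measurable f) (hg : Measurable g)
    (hh : Measurable h) (hf0 : ∀ s, 0 ≤ f s) (hg0 : ∀ s, 0 ≤ g s) (hh0 : ∀ s, 0 ≤ h s)
    (hf1 : ∀ s, f s ≤ 1) (hg1 : ∀ s, g s ≤ 1) (hfs : ∀ u < 1, ∃ s, u < f s)
    (hgs : ∀ u < 1, ∃ s, u < g s) {a b : ℝ} (ha : 0 < a) (hb : 0 < b)
    (hmin : ∀ s t, min (f s) (g t) ≤ h (a * s + b * t)) :
    ENNReal.ofReal a * (∫⁻ s, ENNReal.ofReal (f s)) + ENNReal.ofReal b * (∫⁻ s, ENNReal.ofReal (g s))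
      ≤ ∫⁻ s, ENNReal.ofReal (h s) := by
  rw [lintegral_eq_lintegral_meas_lt _ (.of_forall hf0) hf.aemeasurable,
    lintegral_eq_lintegral_meas_lt _ (.of_forall hg0) hg.aemeasurable,
    lintegral_eq_lintegral_meas_lt _ (.of_forall hh0) hh.aemeasurable]
  have anti (k : ℝ → ℝ) : Antitone fun t : ℝ => volume {s | t < k s} := fun t t' htt =>
    measure_mono fun s hs => lt_of_le_of_lt htt hs
  rw [← lintegral_const_mul _ (anti f).measurable, ← lintegral_const_mul _ (anti g).measurable,
    ← lintegral_add_left ((anti f).measurable.const_mul _)]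
  apply lintegral_mono
  intro t
  simp only
  have scale (k : ℝ → ℝ) (c : ℝ) (hc : 0 < c) : ENNReal.ofReal c * volume {s | t < k s}
      = volume ((fun x => c⁻¹ * x) ⁻¹' {s | t < k s}) := by
    rw [Real.volume_preimage_mul_left (by positivity), inv_inv, abs_of_pos hc]
  -- Below level 1 both superlevel sets are non-empty and a{f > t} + b{g > t} ⊆ {h > t}, so the
  -- one-dimensional inequality applies. From level 1 on the left side vanishes.
  rcases lt_or_ge t 1 with ht | ht
  · rw [scale f a ha, scale g b hb]
    apply Real.volume_add_le_of_measurableSet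
    · exact (measurable_const_mul _) (hf measurableSet_Ioi)
    · exact (measurable_const_mul _) (hg measurableSet_Ioi)
    · obtain ⟨s, hs⟩ := hfs t ht
      exact ⟨a * s, by simpa [ha.ne'] using hs⟩
    · obtain ⟨s, hs⟩ := hgs t ht
      exact ⟨b * s, by simpa [hb.ne'] using hs⟩
    · intro x hx y hy
      have := hmin (a⁻¹ * x) (b⁻¹ * y)
      rw [mul_inv_cancel_left₀ ha.ne', mul_inv_cancel_left₀ hb.ne'] at this
      exact lt_of_lt_of_le (lt_min hx hy) this
  · have e1 : {s | t < f s} = ∅ := by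
      ext s; simpa using (hf1 s).trans ht
    have e2 : {s | t < g s} = ∅ := by
      ext s; simpa using (hg1 s).trans ht
    simp [e1, e2]

theorem min_le_rpow_mul_rpow {x y a b : ℝ} (hx : 0 ≤ x) (hy : 0 ≤ y) (ha : 0 ≤ a) (hb : 0 ≤ b)
    (hab : a + b = 1) : min x y ≤ x ^ a * y ^ b := by
  have hm : 0 ≤ min x y := le_min hx hy
  calc min x y = min x y ^ a * min x y ^ b := by
        rw [← Real.rpow_add_of_nonneg hm ha hb, hab, Real.rpow_one]
    _ ≤ _ := by gcongr <;> simp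

/-- The section of a subset of `ℝⁿ⁺¹` over a value of the first coordinate. -/
def consSection {n : ℕ} (A : Set (Fin (n + 1) → ℝ)) (s : ℝ) : Set (Fin n → ℝ) :=
  {y | (Fin.cons s y : Fin (n + 1) → ℝ) ∈ A}

theorem consSection_subset {n : ℕ} (A : Set (Fin (n + 1) → ℝ)) (s : ℝ) :
    consSection A s ⊆ (Fin.tail : (Fin (n + 1) → ℝ) → Fin n → ℝ) '' A :=
  fun y hy => ⟨_, hy, by simp⟩

theorem continuous_fin_tail {n : ℕ} : Continuous (Fin.tail : (Fin (n + 1) → ℝ) → Fin n → ℝ) :=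
  continuous_pi fun i => continuous_apply i.succ

theorem IsCompact.consSection {n : ℕ} {A : Set (Fin (n + 1) → ℝ)} (hA : IsCompact A) (s : ℝ) :
    IsCompact (consSection A s) := by
  refine (hA.image continuous_fin_tail).of_isClosed_subset ?_ (consSection_subset A s)
  exact hA.isClosed.preimage (by fun_prop : Continuous fun y : Fin n → ℝ =>
    (Fin.cons s y : Fin (n + 1) → ℝ))

theorem IsCompact.volume_consSection_le {n : ℕ} {A : Set (Fin (n + 1) → ℝ)} (hA : IsCompact A)
    (s : ℝ) : volume.real (_root_.consSection A s) ≤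
      volume.real ((Fin.tail : (Fin (n + 1) → ℝ) → Fin n → ℝ) '' A) :=
  measureReal_mono (consSection_subset A s) (hA.image continuous_fin_tail).measure_lt_top.ne

theorem volume_eq_lintegral_consSection {n : ℕ} {A : Set (Fin (n + 1) → ℝ)}
    (hA : MeasurableSet A) : volume A = ∫⁻ s, volume (consSection A s) := by
  have h := (volume_preserving_piFinSuccAbove (fun _ : Fin (n + 1) => ℝ) 0).symm
  rw [← h.measure_preimage hA.nullMeasurableSet, Measure.volume_eq_prod,
    Measure.prod_apply ((MeasurableEquiv.measurable _) hA)]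
  congr! with s
  ext y
  simp [consSection, MeasurableEquiv.piFinSuccAbove, Fin.insertNthEquiv]

theorem measurable_volume_consSection {n : ℕ} {A : Set (Fin (n + 1) → ℝ)}
    (hA : MeasurableSet A) : Measurable fun s => volume (consSection A s) := by
  have h := measurable_measure_prodMk_left (ν := (volume : Measure (Fin n → ℝ)))
    ((MeasurableEquiv.piFinSuccAbove (fun _ : Fin (n + 1) => ℝ) 0).symm.measurable hA)
  convert h using 3 with s
  ext y
  simp [consSection, MeasurableEquiv.piFinSuccAbove, Fin.insertNthEquiv]

theorem IsCompact.lintegral_consSection {n : ℕ} {A : Set (Fin (n + 1) → ℝ)} (hA : IsCompact A)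
    (c : ℝ) : ∫⁻ s, ENNReal.ofReal (volume.real (_root_.consSection A s) / c) =
      ENNReal.ofReal (volume.real A / c) := by
  have h1 : ∀ s, ENNReal.ofReal (volume.real (_root_.consSection A s) / c) =
      volume (_root_.consSection A s) * ENNReal.ofReal c⁻¹ := by
    intro s
    rw [div_eq_mul_inv, ENNReal.ofReal_mul measureReal_nonneg,
      ofReal_measureReal (hA.consSection s).measure_lt_top.ne]
  simp_rw [h1]
  rw [lintegral_mul_const _ (measurable_volume_consSection hA.measurableSet),
    ← volume_eq_lintegral_consSection hA.measurableSet, div_eq_mul_inv,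
    ENNReal.ofReal_mul measureReal_nonneg, ofReal_measureReal hA.measure_lt_top.ne]

/-- Induction on the dimension through hyperplane sections. Section volumes of A and B are divided
by their suprema α and β, those of C by α^a β^b. The induction hypothesis then gives the hypothesis
on minima in `lintegral_convex_comb_le_of_min_le`, whose conclusion a|A|/α + b|B|/β ≤ |C|/(α^a β^b)
yields the claim by the AM–GM inequality. -/
theorem brunn_minkowski_mul : ∀ {n : ℕ} {A B C : Set (Fin n → ℝ)}, IsCompact A → IsCompact B →
    IsCompact C → A.Nonempty → B.Nonempty → ∀ {a b : ℝ}, 0 < a → 0 < b → a + b = 1 →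
    (∀ x ∈ A, ∀ y ∈ B, a • x + b • y ∈ C) →
    volume.real A ^ a * volume.real B ^ b ≤ volume.real C := by
  intro n
  induction n with
  | zero =>
    intro A B C hA hB hC ⟨x, hx⟩ ⟨y, hy⟩ a b ha hb hab h
    have key : ∀ S : Set (Fin 0 → ℝ), S.Nonempty → volume.real S = 1 := by
      rintro S ⟨z, hz⟩
      have : S = Set.univ := Set.eq_univ_of_forall fun w => by rwa [Subsingleton.elim w z]
      rw [this, Measure.real, volume_pi, Measure.pi_of_empty (x := z)]
      simp
    rw [key A ⟨x, hx⟩, key B ⟨y, hy⟩, key C ⟨_, h x hx y hy⟩]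
    simp
  | succ n ih =>
    intro A B C hA hB hC hA' hB' a b ha hb hab h
    rcases (measureReal_nonneg : 0 ≤ volume.real A).eq_or_lt' with hA0 | hA0
    · rw [hA0, Real.zero_rpow ha.ne', zero_mul]; exact measureReal_nonneg
    rcases (measureReal_nonneg : 0 ≤ volume.real B).eq_or_lt' with hB0 | hB0
    · rw [hB0, Real.zero_rpow hb.ne', mul_zero]; exact measureReal_nonneg
    have bdd {S : Set (Fin (n + 1) → ℝ)} (hS : IsCompact S) :
        BddAbove (Set.range fun s => volume.real (consSection S s)) :=
      ⟨_, Set.forall_mem_range.2 hS.volume_consSection_le⟩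
    have sup_pos {S : Set (Fin (n + 1) → ℝ)} (hS : IsCompact S) (hS0 : 0 < volume.real S) :
        0 < ⨆ s, volume.real (consSection S s) := by
      by_contra! hle
      have h0 : ∀ s, volume.real (consSection S s) = 0 := fun s =>
        le_antisymm ((le_ciSup (bdd hS) s).trans hle) measureReal_nonneg
      have := hS.lintegral_consSection 1
      simp only [h0, ENNReal.ofReal_zero, lintegral_zero, div_one] at this
      exact absurd (ENNReal.ofReal_eq_zero.1 this.symm) (not_le.2 hS0)
    have hα := sup_pos hA hA0
    have hβ := sup_pos hB hB0
    set α := ⨆ s, volume.real (consSection A s) with hαdef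
    set β := ⨆ s, volume.real (consSection B s) with hβdef
    have hγ : 0 < α ^ a * β ^ b := by positivity
    have meas {S : Set (Fin (n + 1) → ℝ)} (hS : IsCompact S) (c : ℝ) :
        Measurable fun s => volume.real (consSection S s) / c :=
      (measurable_volume_consSection hS.measurableSet).ennreal_toReal.div_const _
    have key := lintegral_convex_comb_le_of_min_le (meas hA α) (meas hB β)
      (meas hC (α ^ a * β ^ b)) (fun s => by positivity) (fun s => by positivity)
      (fun s => by positivity) (fun s => (div_le_one hα).2 (le_ciSup (bdd hA) s))
      (fun s => (div_le_one hβ).2 (le_ciSup (bdd hB) s))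
      (fun u hu => by
        obtain ⟨s, hs⟩ := exists_lt_of_lt_ciSup (show u * α < ⨆ s, volume.real (consSection A s) by
          rw [← hαdef]; nlinarith)
        exact ⟨s, (lt_div_iff₀ hα).2 hs⟩)
      (fun u hu => by
        obtain ⟨s, hs⟩ := exists_lt_of_lt_ciSup (show u * β < ⨆ s, volume.real (consSection B s) by
          rw [← hβdef]; nlinarith)
        exact ⟨s, (lt_div_iff₀ hβ).2 hs⟩) ha hb ?_
    · rw [hA.lintegral_consSection _, hB.lintegral_consSection _,
        hC.lintegral_consSection _, ← ENNReal.ofReal_mul ha.le, ← ENNReal.ofReal_mul hb.le,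
        ← ENNReal.ofReal_add (by positivity) (by positivity),
        ENNReal.ofReal_le_ofReal_iff (by positivity)] at key
      have amgm := Real.geom_mean_le_arith_mean2_weighted ha.le hb.le
        (show 0 ≤ volume.real A / α by positivity) (show 0 ≤ volume.real B / β by positivity) hab
      have := amgm.trans key
      rw [Real.div_rpow hA0.le hα.le, Real.div_rpow hB0.le hβ.le, div_mul_div_comm,
        div_le_div_iff_of_pos_right hγ] at this
      exact this
    · intro s t
      rcases Set.eq_empty_or_nonempty (consSection A s) with h1 | h1
      · simp only [h1, measureReal_empty, zero_div]
        exact (min_le_left _ _).trans (by positivity)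
      rcases Set.eq_empty_or_nonempty (consSection B t) with h2 | h2
      · simp only [h2, measureReal_empty, zero_div]
        exact (min_le_right _ _).trans (by positivity)
      have := ih (hA.consSection s) (hB.consSection t) (hC.consSection (a * s + b * t)) h1 h2
        ha hb hab (by
          intro x hx y hy
          have := h _ hx _ hy
          simp only [consSection, Set.mem_ofPred_eq]
          convert this using 1
          ext i
          refine Fin.cases ?_ (fun i => ?_) i <;> simp)
      refine (min_le_rpow_mul_rpow (by positivity) (by positivity) ha.le hb.le hab).trans ?_
      rw [Real.div_rpow measureReal_nonneg hα.le, Real.div_rpow measureReal_nonneg hβ.le,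
        div_mul_div_comm]
      gcongr

theorem brunn_minkowski_mul_euclidean {n : ℕ} {A B C : Set (EuclideanSpace ℝ (Fin n))}
    (hA : IsCompact A) (hB : IsCompact B) (hC : IsCompact C) (hA' : A.Nonempty) (hB' : B.Nonempty)
    {a b : ℝ} (ha : 0 < a) (hb : 0 < b) (hab : a + b = 1)
    (h : ∀ x ∈ A, ∀ y ∈ B, a • x + b • y ∈ C) :
    volume.real A ^ a * volume.real B ^ b ≤ volume.real C := by
  have vol {S : Set (EuclideanSpace ℝ (Fin n))} (hS : IsCompact S) :
      volume.real (WithLp.ofLp '' S) = volume.real S := by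
    have := (EuclideanSpace.volume_preserving_symm_measurableEquiv_toLp (Fin n)).symm
    rw [Measure.real, Measure.real, ← this.measure_preimage hS.measurableSet.nullMeasurableSet]
    congr 2
    ext y
    constructor
    · rintro ⟨x, hx, rfl⟩; exact hx
    · intro hy; exact ⟨WithLp.toLp 2 y, hy, rfl⟩
  have hc : Continuous (WithLp.ofLp : EuclideanSpace ℝ (Fin n) → Fin n → ℝ) :=
    PiLp.continuous_ofLp _ _
  rw [← vol hA, ← vol hB, ← vol hC]
  refine brunn_minkowski_mul (hA.image hc) (hB.image hc) (hC.image hc) (hA'.image _) (hB'.image _)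
    ha hb hab ?_
  rintro _ ⟨x, hx, rfl⟩ _ ⟨y, hy, rfl⟩
  exact ⟨_, h x hx y hy, rfl⟩

theorem volume_real_smul {n : ℕ} {r : ℝ} (hr : 0 ≤ r) (S : Set (EuclideanSpace ℝ (Fin n))) :
    volume.real (r • S) = r ^ n * volume.real S := by
  rw [Measure.real, Measure.addHaar_smul, ENNReal.toReal_mul, finrank_euclideanSpace_fin,
    ENNReal.toReal_ofReal (abs_nonneg _), abs_of_nonneg (pow_nonneg hr n), Measure.real]

theorem brunn_minkowski {n : ℕ} (hn : n ≠ 0) {A B C : Set (EuclideanSpace ℝ (Fin n))}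
    (hA : IsCompact A) (hB : IsCompact B) (hC : IsCompact C) (hA' : A.Nonempty) (hB' : B.Nonempty)
    (h : ∀ x ∈ A, ∀ y ∈ B, x + y ∈ C) :
    volume.real A ^ (n : ℝ)⁻¹ + volume.real B ^ (n : ℝ)⁻¹ ≤ volume.real C ^ (n : ℝ)⁻¹ := by
  have hn' : (n : ℝ)⁻¹ ≠ 0 := by positivity
  rcases (measureReal_nonneg : 0 ≤ volume.real A).eq_or_lt' with hA0 | hA0
  · obtain ⟨x, hx⟩ := hA'
    rw [hA0, Real.zero_rpow hn', zero_add]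
    refine Real.rpow_le_rpow measureReal_nonneg ?_ (by positivity)
    calc volume.real B = volume.real ((fun y => x + y) '' B) := by
          rw [Set.image_add_left, Measure.real, Measure.real, measure_preimage_add]
      _ ≤ _ := measureReal_mono (by rintro _ ⟨y, hy, rfl⟩; exact h x hx y hy)
            hC.measure_lt_top.ne
  rcases (measureReal_nonneg : 0 ≤ volume.real B).eq_or_lt' with hB0 | hB0
  · obtain ⟨y, hy⟩ := hB'
    rw [hB0, Real.zero_rpow hn', add_zero]
    refine Real.rpow_le_rpow measureReal_nonneg ?_ (by positivity)
    calc volume.real A = volume.real ((fun x => x + y) '' A) := by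
          rw [Set.image_add_right, Measure.real, Measure.real, measure_preimage_add_right]
      _ ≤ _ := measureReal_mono (by rintro _ ⟨x, hx, rfl⟩; exact h x hx y hy)
            hC.measure_lt_top.ne
  set α := volume.real A ^ (n : ℝ)⁻¹ with hαd
  set β := volume.real B ^ (n : ℝ)⁻¹ with hβd
  have hα : 0 < α := by positivity
  have hβ : 0 < β := by positivity
  have e1 : volume.real (α⁻¹ • A) = 1 := by
    rw [volume_real_smul (by positivity), inv_pow, hαd, Real.rpow_inv_natCast_pow hA0.le hn,
      inv_mul_cancel₀ hA0.ne']
  have e2 : volume.real (β⁻¹ • B) = 1 := by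
    rw [volume_real_smul (by positivity), inv_pow, hβd, Real.rpow_inv_natCast_pow hB0.le hn,
      inv_mul_cancel₀ hB0.ne']
  have key := brunn_minkowski_mul_euclidean (hA.smul α⁻¹) (hB.smul β⁻¹) (hC.smul (α + β)⁻¹)
    hA'.smul_set hB'.smul_set (a := α / (α + β)) (b := β / (α + β)) (by positivity) (by positivity)
    (by field_simp) (by
      rintro _ ⟨x, hx, rfl⟩ _ ⟨y, hy, rfl⟩
      refine ⟨_, h x hx y hy, ?_⟩
      simp only [smul_smul, smul_add]
      congr 2 <;> field_simp)
  rw [e1, e2, Real.one_rpow, Real.one_rpow, mul_one, volume_real_smul (by positivity), inv_pow,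
    ← div_eq_inv_mul, one_le_div (by positivity)] at key
  calc α + β = ((α + β) ^ n) ^ (n : ℝ)⁻¹ := (Real.pow_rpow_inv_natCast (by positivity) hn).symm
    _ ≤ _ := by gcongr

/-! ### The covariogram -/

section Covariogram

variable {n : ℕ} {K : Set (EuclideanSpace ℝ (Fin n))}

theorem inter_image_add_eq (K : Set (EuclideanSpace ℝ (Fin n))) (x : EuclideanSpace ℝ (Fin n)) :
    K ∩ (fun y => x + y) '' K = {y | y ∈ K ∧ y - x ∈ K} := by
  ext y
  constructor
  · rintro ⟨h1, z, hz, rfl⟩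
    exact ⟨h1, by simpa using hz⟩
  · rintro ⟨h1, h2⟩
    exact ⟨h1, y - x, h2, by simp⟩

theorem covariogram_eq (K : Set (EuclideanSpace ℝ (Fin n))) (x : EuclideanSpace ℝ (Fin n)) :
    covariogram K x = volume.real {y | y ∈ K ∧ y - x ∈ K} := by
  rw [covariogram, inter_image_add_eq]

theorem isCompact_inter_sub_mem (hK : IsCompact K) (x : EuclideanSpace ℝ (Fin n)) :
    IsCompact {y | y ∈ K ∧ y - x ∈ K} :=
  hK.inter_right (hK.isClosed.preimage (by fun_prop : Continuous fun y => y - x))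

theorem covariogram_nonneg (K : Set (EuclideanSpace ℝ (Fin n))) (x : EuclideanSpace ℝ (Fin n)) :
    0 ≤ covariogram K x := measureReal_nonneg

theorem covariogram_zero (K : Set (EuclideanSpace ℝ (Fin n))) :
    covariogram K 0 = volume.real K := by simp [covariogram_eq]

theorem covariogram_le (hK : IsCompact K) (x : EuclideanSpace ℝ (Fin n)) :
    covariogram K x ≤ volume.real K := by
  rw [covariogram_eq]
  exact measureReal_mono (fun y hy => hy.1) hK.measure_lt_top.ne

theorem measurable_covariogram (hK : IsCompact K) : Measurable (covariogram K) := by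
  have h : MeasurableSet {q : EuclideanSpace ℝ (Fin n) × EuclideanSpace ℝ (Fin n) |
      q.2 ∈ K ∧ q.2 - q.1 ∈ K} :=
    (hK.measurableSet.preimage measurable_snd).inter
      (hK.measurableSet.preimage (measurable_snd.sub measurable_fst))
  have := (measurable_measure_prodMk_left (ν := volume) h).ennreal_toReal
  convert this using 1
  ext x
  rw [covariogram_eq]
  rfl

theorem covariogram_neg (K : Set (EuclideanSpace ℝ (Fin n))) (x : EuclideanSpace ℝ (Fin n)) :
    covariogram K (-x) = covariogram K x := by
  rw [covariogram_eq, covariogram_eq, Measure.real, Measure.real,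
    ← measure_preimage_add_right volume x {y | y ∈ K ∧ y - x ∈ K}]
  congr 2
  ext y
  simp [and_comm]

theorem nonempty_of_covariogram_ne_zero {x : EuclideanSpace ℝ (Fin n)}
    (hx : covariogram K x ≠ 0) : {y | y ∈ K ∧ y - x ∈ K}.Nonempty := by
  by_contra h
  rw [Set.not_nonempty_iff_eq_empty] at h
  rw [covariogram_eq, h] at hx
  simp at hx

theorem exists_norm_le_of_covariogram_ne_zero (hK : IsCompact K) :
    ∃ R > 0, ∀ x, covariogram K x ≠ 0 → ‖x‖ ≤ R := by
  obtain ⟨R, hR, h⟩ := hK.isBounded.exists_pos_norm_le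
  refine ⟨R + R, by positivity, fun x hx => ?_⟩
  obtain ⟨y, hy, hy'⟩ := nonempty_of_covariogram_ne_zero hx
  have := norm_sub_le y (y - x)
  rw [sub_sub_cancel] at this
  exact this.trans (add_le_add (h _ hy) (h _ hy'))

theorem exists_le_covariogram (hK : IsConvexBody K) :
    ∃ r > 0, ∃ c > 0, ∀ x, ‖x‖ ≤ r → c ≤ covariogram K x := by
  obtain ⟨z, hz⟩ := hK.2.2
  obtain ⟨r, hr, hb⟩ := Metric.isOpen_iff.1 isOpen_interior z hz
  have hb' := hb.trans interior_subset
  refine ⟨r / 2, by positivity, volume.real (Metric.ball z (r / 2)), ?_, fun x hx => ?_⟩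
  · exact ENNReal.toReal_pos (Metric.measure_ball_pos _ _ (by positivity)).ne' measure_ball_lt_top.ne
  · rw [covariogram_eq]
    refine measureReal_mono (fun y hy => ?_) (isCompact_inter_sub_mem hK.1 x).measure_lt_top.ne
    rw [Metric.mem_ball, dist_eq_norm] at hy
    refine ⟨hb' ?_, hb' ?_⟩
    · rw [Metric.mem_ball, dist_eq_norm]; linarith
    · rw [Metric.mem_ball, dist_eq_norm]
      have : ‖y - x - z‖ ≤ ‖y - z‖ + ‖x‖ := by
        rw [show y - x - z = (y - z) - x by abel]; exact norm_sub_le _ _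
      linarith

theorem Convex.combo_mem_inter_sub_mem (hK : Convex ℝ K) {x y u v : EuclideanSpace ℝ (Fin n)}
    (hu : u ∈ K ∧ u - x ∈ K) (hv : v ∈ K ∧ v - y ∈ K) {a b : ℝ} (ha : 0 ≤ a) (hb : 0 ≤ b)
    (hab : a + b = 1) :
    a • u + b • v ∈ K ∧ a • u + b • v - (a • x + b • y) ∈ K := by
  refine ⟨hK hu.1 hv.1 ha hb hab, ?_⟩
  have := hK hu.2 hv.2 ha hb hab
  rwa [smul_sub, smul_sub, sub_add_sub_comm] at this

theorem convex_inter_sub_mem (hK : Convex ℝ K) (x : EuclideanSpace ℝ (Fin n)) :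
    Convex ℝ {y | y ∈ K ∧ y - x ∈ K} := by
  intro u hu v hv a b ha hb hab
  have := hK.combo_mem_inter_sub_mem hu hv ha hb hab
  rwa [← add_smul, hab, one_smul] at this

theorem covariogram_rpow_mul_rpow_le (hK : IsCompact K) (hc : Convex ℝ K)
    (x y : EuclideanSpace ℝ (Fin n)) {a b : ℝ} (ha : 0 < a) (hb : 0 < b) (hab : a + b = 1) :
    covariogram K x ^ a * covariogram K y ^ b ≤ covariogram K (a • x + b • y) := by
  by_cases hx : covariogram K x = 0
  · rw [hx, Real.zero_rpow ha.ne', zero_mul]; exact covariogram_nonneg _ _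
  by_cases hy : covariogram K y = 0
  · rw [hy, Real.zero_rpow hb.ne', mul_zero]; exact covariogram_nonneg _ _
  have h1 := nonempty_of_covariogram_ne_zero hx
  have h2 := nonempty_of_covariogram_ne_zero hy
  simp only [covariogram_eq]
  exact brunn_minkowski_mul_euclidean (isCompact_inter_sub_mem hK x) (isCompact_inter_sub_mem hK y)
    (isCompact_inter_sub_mem hK _) h1 h2 ha hb hab
    fun u hu v hv => hc.combo_mem_inter_sub_mem hu hv ha.le hb.le hab

/-- The set a(K ∩ (x + K)) + b(K ∩ (y + K)) lies in K ∩ (ax + by + K). Both values must be non-zero,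
since concavity of the root holds only on the support. -/
theorem covariogram_root_concave (hn : n ≠ 0) (hK : IsCompact K) (hc : Convex ℝ K)
    {x y : EuclideanSpace ℝ (Fin n)} (hx : covariogram K x ≠ 0) (hy : covariogram K y ≠ 0)
    {a b : ℝ} (ha : 0 < a) (hb : 0 < b) (hab : a + b = 1) :
    a * covariogram K x ^ (n : ℝ)⁻¹ + b * covariogram K y ^ (n : ℝ)⁻¹ ≤
      covariogram K (a • x + b • y) ^ (n : ℝ)⁻¹ := by
  have h1 := nonempty_of_covariogram_ne_zero hx
  have h2 := nonempty_of_covariogram_ne_zero hy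
  have scale (w : EuclideanSpace ℝ (Fin n)) {r : ℝ} (hr : 0 < r) :
      r * covariogram K w ^ (n : ℝ)⁻¹ =
        volume.real (r • {u | u ∈ K ∧ u - w ∈ K}) ^ (n : ℝ)⁻¹ := by
    rw [volume_real_smul hr.le, Real.mul_rpow (by positivity) measureReal_nonneg,
      Real.pow_rpow_inv_natCast hr.le hn, covariogram_eq]
  rw [scale x ha, scale y hb, covariogram_eq]
  refine brunn_minkowski hn ((isCompact_inter_sub_mem hK x).smul a)
    ((isCompact_inter_sub_mem hK y).smul b) (isCompact_inter_sub_mem hK _) h1.smul_set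
    h2.smul_set ?_
  rintro _ ⟨u, hu, rfl⟩ _ ⟨v, hv, rfl⟩
  exact hc.combo_mem_inter_sub_mem hu hv ha.le hb.le hab

/-- The properties of the covariogram of a convex body of volume `1` that make its Ball bodies
convex bodies. -/
structure IsLogConcaveDensity (g : EuclideanSpace ℝ (Fin n) → ℝ) : Prop where
  measurable : Measurable g
  nonneg : ∀ x, 0 ≤ g x
  zero_eq : g 0 = 1
  le_one : ∀ x, g x ≤ 1
  exists_norm_le : ∃ R > 0, ∀ x, g x ≠ 0 → ‖x‖ ≤ R
  exists_le : ∃ r > 0, ∃ c > 0, ∀ x, ‖x‖ ≤ r → c ≤ g x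
  rpow_mul_rpow_le : ∀ x y : EuclideanSpace ℝ (Fin n), ∀ {a b : ℝ}, 0 < a → 0 < b → a + b = 1 →
    g x ^ a * g y ^ b ≤ g (a • x + b • y)

theorem isLogConcaveDensity_covariogram (hK : IsConvexBody K) (h1 : volume K = 1) :
    IsLogConcaveDensity (covariogram K) where
  measurable := measurable_covariogram hK.1
  nonneg := covariogram_nonneg K
  zero_eq := by simp [covariogram_zero, Measure.real, h1]
  le_one x := (covariogram_le hK.1 x).trans (by simp [Measure.real, h1])
  exists_norm_le := exists_norm_le_of_covariogram_ne_zero hK.1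
  exists_le := exists_le_covariogram hK
  rpow_mul_rpow_le := covariogram_rpow_mul_rpow_le hK.1 hK.2.1

end Covariogram

/-! ### Ball's bodies -/

section BallBody

variable {n : ℕ} {g : EuclideanSpace ℝ (Fin n) → ℝ} {p : ℝ}

/-- The radial moment `∫₀^∞ p t^(p-1) g(tx) dt`. -/
noncomputable def radialMoment (p : ℝ) (g : EuclideanSpace ℝ (Fin n) → ℝ)
    (x : EuclideanSpace ℝ (Fin n)) : ENNReal :=
  ∫⁻ t : ℝ in Set.Ioi 0, ENNReal.ofReal (p * t ^ (p - 1) * g (t • x))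

theorem IsLogConcaveDensity.mem_ballBody (hg : IsLogConcaveDensity g)
    {x : EuclideanSpace ℝ (Fin n)} : x ∈ ballBody p g ↔ 1 ≤ radialMoment p g x := by
  rw [← ENNReal.ofReal_one, ← hg.zero_eq]
  rfl

/-- Homogeneity of degree -p: Ball's body is a superlevel set of a homogeneous function, hence
determined by its extent on each ray. -/
theorem radialMoment_smul (x : EuclideanSpace ℝ (Fin n)) {c : ℝ} (hc : 0 < c) :
    radialMoment p g (c • x) = ENNReal.ofReal (c ^ (-p)) * radialMoment p g x := by
  have himg : (fun t : ℝ => c * t) '' Set.Ioi 0 = Set.Ioi 0 := by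
    ext t
    constructor
    · rintro ⟨u, hu, rfl⟩; exact mul_pos hc hu
    · intro ht; exact ⟨c⁻¹ * t, mul_pos (inv_pos.2 hc) ht, by field_simp⟩
  have h := lintegral_image_eq_lintegral_abs_deriv_mul (s := Set.Ioi (0 : ℝ))
    (f := fun t => c * t) (f' := fun _ => c) measurableSet_Ioi
    (fun t _ => by simpa using ((hasDerivAt_id t).const_mul c).hasDerivWithinAt)
    (fun a _ b _ hab => mul_left_cancel₀ hc.ne' hab)
    (fun t => ENNReal.ofReal (p * t ^ (p - 1) * g (t • x)))
  rw [himg] at h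
  rw [radialMoment, radialMoment, h, ← lintegral_const_mul' _ _ ENNReal.ofReal_ne_top]
  refine setLIntegral_congr_fun measurableSet_Ioi fun t ht => ?_
  have ht' : (0 : ℝ) < t := ht
  rw [← ENNReal.ofReal_mul (abs_nonneg _), ← ENNReal.ofReal_mul (by positivity), abs_of_pos hc,
    Real.mul_rpow hc.le ht'.le, smul_smul, mul_comm t c, Real.rpow_sub_one hc.ne',
    Real.rpow_neg hc.le]
  congr 1
  have : c ^ p ≠ 0 := by positivity
  field_simp

/-- The variable ρ = 1/t suits convexity: (ax + by)/(as + bt) is a convex combination of x/s and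
y/t. -/
theorem radialMoment_eq_inv (hp : 0 < p) (x : EuclideanSpace ℝ (Fin n)) :
    radialMoment p g x =
      ∫⁻ ρ : ℝ in Set.Ioi 0, ENNReal.ofReal (p * (ρ ^ (-(p + 1)) * g (ρ⁻¹ • x))) := by
  have himg : (fun t : ℝ => t⁻¹) '' Set.Ioi 0 = Set.Ioi 0 := by
    ext t
    constructor
    · rintro ⟨u, hu, rfl⟩; exact Set.mem_Ioi.2 (inv_pos.2 hu)
    · intro ht; exact ⟨t⁻¹, Set.mem_Ioi.2 (inv_pos.2 ht), inv_inv t⟩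
  have h := lintegral_image_eq_lintegral_abs_deriv_mul (s := Set.Ioi (0 : ℝ))
    (f := fun t => t⁻¹) (f' := fun t => -(t ^ 2)⁻¹) measurableSet_Ioi
    (fun t ht => (hasDerivAt_inv (ne_of_gt ht)).hasDerivWithinAt)
    (fun a _ b _ hab => inv_injective hab)
    (fun t => ENNReal.ofReal (p * t ^ (p - 1) * g (t • x)))
  rw [himg] at h
  rw [radialMoment, h]
  refine setLIntegral_congr_fun measurableSet_Ioi fun t ht => ?_
  have ht' : (0 : ℝ) < t := ht
  rw [← ENNReal.ofReal_mul (abs_nonneg _), abs_neg, abs_of_pos (by positivity),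
    Real.inv_rpow ht'.le, Real.rpow_neg ht'.le, Real.rpow_sub_one ht'.ne', Real.rpow_add_one ht'.ne']
  congr 1
  have : t ^ p ≠ 0 := by positivity
  field_simp

/-- The integrand of the radial moment after the substitution `ρ = 1 / t`. -/
noncomputable def invProfile (p : ℝ) (g : EuclideanSpace ℝ (Fin n) → ℝ)
    (x : EuclideanSpace ℝ (Fin n)) (ρ : ℝ) : ℝ :=
  if 0 < ρ then ρ ^ (-(p + 1)) * g (ρ⁻¹ • x) else 0

theorem invProfile_of_pos (x : EuclideanSpace ℝ (Fin n)) {ρ : ℝ} (hρ : 0 < ρ) :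
    invProfile p g x ρ = ρ ^ (-(p + 1)) * g (ρ⁻¹ • x) := if_pos hρ

theorem radialMoment_eq_invProfile (hp : 0 < p) (x : EuclideanSpace ℝ (Fin n)) :
    radialMoment p g x = ENNReal.ofReal p * ∫⁻ ρ, ENNReal.ofReal (invProfile p g x ρ) := by
  rw [radialMoment_eq_inv hp, ← lintegral_const_mul' _ _ ENNReal.ofReal_ne_top,
    ← lintegral_indicator measurableSet_Ioi]
  congr! with ρ
  by_cases h : 0 < ρ
  · rw [Set.indicator_of_mem (Set.mem_Ioi.2 h), invProfile_of_pos x h, ENNReal.ofReal_mul hp.le]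
  · rw [Set.indicator_of_notMem (mt Set.mem_Ioi.1 h), invProfile, if_neg h]; simp

namespace IsLogConcaveDensity

variable (hg : IsLogConcaveDensity g)
include hg

theorem measurable_smul (x : EuclideanSpace ℝ (Fin n)) : Measurable fun t : ℝ => g (t • x) :=
  hg.measurable.comp (by fun_prop)

theorem measurable_invProfile (x : EuclideanSpace ℝ (Fin n)) : Measurable (invProfile p g x) := by
  refine Measurable.ite measurableSet_Ioi ?_ measurable_const
  exact (by fun_prop : Measurable fun ρ : ℝ => ρ ^ (-(p + 1))).mul
    ((hg.measurable_smul x).comp measurable_inv)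

theorem invProfile_nonneg (x : EuclideanSpace ℝ (Fin n)) (ρ : ℝ) : 0 ≤ invProfile p g x ρ := by
  unfold invProfile
  have := hg.nonneg (ρ⁻¹ • x)
  split_ifs <;> positivity

theorem bddAbove_invProfile (hp : 0 < p) {x : EuclideanSpace ℝ (Fin n)} (hx : x ≠ 0) :
    BddAbove (Set.range (invProfile p g x)) := by
  obtain ⟨R, hR, h⟩ := hg.exists_norm_le
  have hx' : 0 < ‖x‖ := norm_pos_iff.2 hx
  refine ⟨(R / ‖x‖) ^ (p + 1), Set.forall_mem_range.2 fun ρ => ?_⟩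
  by_cases hρ : 0 < ρ
  · rw [invProfile_of_pos x hρ]
    by_cases h0 : g (ρ⁻¹ • x) = 0
    · rw [h0, mul_zero]; positivity
    · have h1 := h _ h0
      rw [norm_smul, norm_inv, Real.norm_of_nonneg hρ.le] at h1
      calc ρ ^ (-(p + 1)) * g (ρ⁻¹ • x) ≤ ρ ^ (-(p + 1)) * 1 := by gcongr; exact hg.le_one _
        _ = (ρ⁻¹) ^ (p + 1) := by rw [mul_one, Real.rpow_neg hρ.le, Real.inv_rpow hρ.le]
        _ ≤ _ := by gcongr; rwa [le_div_iff₀ hx']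
  · rw [invProfile, if_neg hρ]; positivity

theorem iSup_invProfile_pos (hp : 0 < p) {x : EuclideanSpace ℝ (Fin n)} (hx : x ≠ 0) :
    0 < ⨆ ρ, invProfile p g x ρ := by
  obtain ⟨r, hr, c, hc, h⟩ := hg.exists_le
  have hx' : 0 < ‖x‖ := norm_pos_iff.2 hx
  refine lt_of_lt_of_le ?_ (le_ciSup (hg.bddAbove_invProfile hp hx) (‖x‖ / r))
  rw [invProfile_of_pos x (by positivity)]
  refine mul_pos (by positivity) (hc.trans_le (h _ ?_))
  rw [norm_smul, norm_inv, norm_div, norm_norm, Real.norm_of_nonneg hr.le]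
  field_simp
  rfl

/-- With τ = as + bt, the weights μ = as/τ and ν = bt/τ satisfy μ(x/s) + ν(y/t) = (ax + by)/τ.
Log-concavity of g handles its values, and AM–GM gives (A/s)^μ (B/t)^ν ≤ (aA + bB)/τ for the powers.
-/
theorem min_invProfile_le (hp : 0 < p) (x y : EuclideanSpace ℝ (Fin n)) {a b A B : ℝ} (ha : 0 < a)
    (hb : 0 < b) (hA : 0 < A) (hB : 0 < B) (s t : ℝ) :
    min (A ^ (p + 1) * invProfile p g x s) (B ^ (p + 1) * invProfile p g y t) ≤
      (a * A + b * B) ^ (p + 1) * invProfile p g (a • x + b • y) (a * s + b * t) := by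
  have hpos : 0 ≤ (a * A + b * B) ^ (p + 1) * invProfile p g (a • x + b • y) (a * s + b * t) :=
    mul_nonneg (by positivity) (hg.invProfile_nonneg _ _)
  by_cases hs : 0 < s
  swap
  · rw [invProfile, if_neg hs, mul_zero]; exact (min_le_left _ _).trans hpos
  by_cases ht : 0 < t
  swap
  · rw [invProfile.eq_1 p g y, if_neg ht, mul_zero]; exact (min_le_right _ _).trans hpos
  have hτ : 0 < a * s + b * t := by positivity
  rw [invProfile_of_pos x hs, invProfile_of_pos y ht, invProfile_of_pos _ hτ]
  set τ := a * s + b * t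
  set μ := a * s / τ with hμ
  set ν := b * t / τ with hν
  have hμ0 : 0 < μ := by positivity
  have hν0 : 0 < ν := by positivity
  have hμν : μ + ν = 1 := by rw [hμ, hν, ← add_div, div_self hτ.ne']
  have hgx := hg.nonneg (s⁻¹ • x)
  have hgy := hg.nonneg (t⁻¹ • y)
  have e (A s u : ℝ) (hA : 0 < A) (hs : 0 < s) :
      A ^ (p + 1) * (s ^ (-(p + 1)) * u) = (A / s) ^ (p + 1) * u := by
    rw [Real.rpow_neg hs.le, Real.div_rpow hA.le hs.le]; ring
  rw [e _ _ _ hA hs, e _ _ _ hB ht, e _ _ _ (by positivity) hτ]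
  have h1 : g (s⁻¹ • x) ^ μ * g (t⁻¹ • y) ^ ν ≤ g (τ⁻¹ • (a • x + b • y)) := by
    convert hg.rpow_mul_rpow_le (s⁻¹ • x) (t⁻¹ • y) hμ0 hν0 hμν using 2
    rw [smul_add, smul_smul, smul_smul, smul_smul, smul_smul]
    congr 2 <;> (simp only [hμ, hν]; field_simp)
  have h2 : (A / s) ^ μ * (B / t) ^ ν ≤ (a * A + b * B) / τ := by
    convert Real.geom_mean_le_arith_mean2_weighted hμ0.le hν0.le (show 0 ≤ A / s by positivity)
      (show 0 ≤ B / t by positivity) hμν using 1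
    simp only [hμ, hν]; field_simp
  calc _ ≤ ((A / s) ^ (p + 1) * g (s⁻¹ • x)) ^ μ * ((B / t) ^ (p + 1) * g (t⁻¹ • y)) ^ ν :=
        min_le_rpow_mul_rpow (by positivity) (by positivity) hμ0.le hν0.le hμν
    _ = ((A / s) ^ μ * (B / t) ^ ν) ^ (p + 1) * (g (s⁻¹ • x) ^ μ * g (t⁻¹ • y) ^ ν) := by
        rw [Real.mul_rpow (by positivity) hgx, Real.mul_rpow (by positivity) hgy,
          Real.mul_rpow (x := (A / s) ^ μ) (by positivity) (by positivity),
          ← Real.rpow_mul (by positivity), ← Real.rpow_mul (by positivity),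
          ← Real.rpow_mul (by positivity), ← Real.rpow_mul (by positivity), mul_comm μ, mul_comm ν]
        ring
    _ ≤ _ := by gcongr

theorem smul_mem_ballBody (hp : 0 < p) {x : EuclideanSpace ℝ (Fin n)} (hx : x ∈ ballBody p g)
    {c : ℝ} (hc : 0 < c) (hc1 : c ≤ 1) : c • x ∈ ballBody p g := by
  rw [hg.mem_ballBody] at hx ⊢
  rw [radialMoment_smul x hc]
  refine hx.trans (le_mul_of_one_le_left zero_le ?_)
  rw [ENNReal.one_le_ofReal]
  exact Real.one_le_rpow_of_pos_of_le_one_of_nonpos hc hc1 (by linarith)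

theorem convex_ballBody (hp : 0 < p) : Convex ℝ (ballBody p g) := by
  rw [convex_iff_forall_pos]
  intro x hx y hy a b ha hb hab
  by_cases hx0 : x = 0
  · rw [hx0, smul_zero, zero_add]; exact hg.smul_mem_ballBody hp hy hb (by linarith)
  by_cases hy0 : y = 0
  · rw [hy0, smul_zero, add_zero]; exact hg.smul_mem_ballBody hp hx ha (by linarith)
  have hS := hg.iSup_invProfile_pos hp hx0
  have hS' := hg.iSup_invProfile_pos hp hy0
  have bS := hg.bddAbove_invProfile hp hx0
  have bS' := hg.bddAbove_invProfile hp hy0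
  set S := ⨆ ρ, invProfile p g x ρ with hSd
  set S' := ⨆ ρ, invProfile p g y ρ with hSd'
  have hp1 : p + 1 ≠ 0 := by linarith
  -- A and B are chosen so that the inverse profiles, multiplied by A^(p+1) and B^(p+1), have
  -- supremum 1.
  set A := S⁻¹ ^ (p + 1)⁻¹ with hAd
  set B := S'⁻¹ ^ (p + 1)⁻¹ with hBd
  have hA : 0 < A := by positivity
  have hB : 0 < B := by positivity
  have hAS : A ^ (p + 1) = S⁻¹ := Real.rpow_inv_rpow (by positivity) hp1
  have hBS : B ^ (p + 1) = S'⁻¹ := Real.rpow_inv_rpow (by positivity) hp1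
  have nn (w) (ρ) : 0 ≤ invProfile p g w ρ := hg.invProfile_nonneg w ρ
  have level := lintegral_convex_comb_le_of_min_le
    (f := fun ρ => A ^ (p + 1) * invProfile p g x ρ)
    (g := fun ρ => B ^ (p + 1) * invProfile p g y ρ)
    (h := fun ρ => (a * A + b * B) ^ (p + 1) * invProfile p g (a • x + b • y) ρ)
    ((hg.measurable_invProfile x).const_mul _) ((hg.measurable_invProfile y).const_mul _)
    ((hg.measurable_invProfile _).const_mul _)
    (fun s => mul_nonneg (by positivity) (nn _ _)) (fun s => mul_nonneg (by positivity) (nn _ _))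
    (fun s => mul_nonneg (by positivity) (nn _ _))
    (fun s => by
      rw [hAS, inv_mul_le_iff₀ hS, mul_one]; exact le_ciSup bS s)
    (fun s => by
      rw [hBS, inv_mul_le_iff₀ hS', mul_one]; exact le_ciSup bS' s)
    (fun u hu => by
      obtain ⟨s, hs⟩ := exists_lt_of_lt_ciSup (show S * u < ⨆ ρ, invProfile p g x ρ by
        rw [← hSd]; nlinarith)
      exact ⟨s, by rwa [hAS, lt_inv_mul_iff₀ hS]⟩)
    (fun u hu => by
      obtain ⟨s, hs⟩ := exists_lt_of_lt_ciSup (show S' * u < ⨆ ρ, invProfile p g y ρ by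
        rw [← hSd']; nlinarith)
      exact ⟨s, by rwa [hBS, lt_inv_mul_iff₀ hS']⟩)
    ha hb (hg.min_invProfile_le hp x y ha hb hA hB)
  rw [hg.mem_ballBody] at hx hy ⊢
  have pull (w : EuclideanSpace ℝ (Fin n)) (c : ℝ) (hc : 0 ≤ c) :
      ENNReal.ofReal p * ∫⁻ ρ, ENNReal.ofReal (c * invProfile p g w ρ) =
        ENNReal.ofReal c * radialMoment p g w := by
    simp_rw [ENNReal.ofReal_mul hc]
    rw [lintegral_const_mul' _ _ ENNReal.ofReal_ne_top, radialMoment_eq_invProfile hp]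
    ring
  have level' := mul_le_mul_right level (ENNReal.ofReal p)
  rw [mul_add, mul_left_comm (ENNReal.ofReal p), pull _ _ (by positivity),
    mul_left_comm (ENNReal.ofReal p), pull _ _ (by positivity),
    pull _ _ (by positivity)] at level'
  -- Writing M for the radial moment, `level'` says a A^(p+1) M(x) + b B^(p+1) M(y) ≤ (aA +
  -- bB)^(p+1) M(ax + by). As M(x), M(y) ≥ 1, convexity of the power p + 1 leaves M(ax + by) ≥ 1.
  have conv : (a * A + b * B) ^ (p + 1) ≤ a * A ^ (p + 1) + b * B ^ (p + 1) := by
    simpa using (convexOn_rpow (show 1 ≤ p + 1 by linarith)).2 hA.le hB.le ha.le hb.le hab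
  have hκ : 0 < (a * A + b * B) ^ (p + 1) := by positivity
  have fin : ENNReal.ofReal ((a * A + b * B) ^ (p + 1)) * 1 ≤
      ENNReal.ofReal ((a * A + b * B) ^ (p + 1)) * radialMoment p g (a • x + b • y) := by
    refine le_trans ?_ level'
    calc _ ≤ ENNReal.ofReal (a * A ^ (p + 1) + b * B ^ (p + 1)) := by
          rw [mul_one]; exact ENNReal.ofReal_le_ofReal conv
      _ = ENNReal.ofReal a * (ENNReal.ofReal (A ^ (p + 1)) * 1) +
          ENNReal.ofReal b * (ENNReal.ofReal (B ^ (p + 1)) * 1) := by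
          rw [ENNReal.ofReal_add (by positivity) (by positivity), ENNReal.ofReal_mul ha.le,
            ENNReal.ofReal_mul hb.le, mul_one, mul_one]
      _ ≤ _ := by gcongr
  exact (ENNReal.mul_le_mul_iff_right (by simpa using hκ) ENNReal.ofReal_ne_top).1 fin

theorem radialMoment_le (hp : 0 < p) :
    ∃ m > 0, ∀ x ≠ 0, radialMoment p g x ≤ ENNReal.ofReal (m * ‖x‖ ^ (-p)) := by
  obtain ⟨R, hR, h⟩ := hg.exists_norm_le
  have hint : IntegrableOn (fun t : ℝ => p * t ^ (p - 1)) (Set.Ioc 0 R) :=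
    ((intervalIntegral.intervalIntegrable_rpow' (by linarith)).1.const_mul p)
  have hnn : ∀ t ∈ Set.Ioc (0 : ℝ) R, 0 ≤ p * t ^ (p - 1) := fun t ht => by
    have := ht.1; positivity
  -- The integral bounds the moment at unit vectors, where g ≤ 1 vanishes beyond R; adding 1 makes
  -- positivity of the constant immediate.
  refine ⟨(∫ t in Set.Ioc 0 R, p * t ^ (p - 1)) + 1, ?_, fun x hx => ?_⟩
  · have := setIntegral_nonneg (μ := volume) measurableSet_Ioc hnn
    linarith
  have hx' : 0 < ‖x‖ := norm_pos_iff.2 hx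
  have hu : ∀ u : EuclideanSpace ℝ (Fin n), ‖u‖ = 1 →
      radialMoment p g u ≤ ENNReal.ofReal ((∫ t in Set.Ioc 0 R, p * t ^ (p - 1)) + 1) := by
    intro u hu
    calc radialMoment p g u ≤ ∫⁻ t in Set.Ioc 0 R, ENNReal.ofReal (p * t ^ (p - 1)) := by
          rw [radialMoment, ← lintegral_indicator measurableSet_Ioi,
            ← lintegral_indicator measurableSet_Ioc]
          refine lintegral_mono fun t => ?_
          by_cases ht : 0 < t
          swap
          · rw [Set.indicator_of_notMem (mt Set.mem_Ioi.1 ht)]; exact zero_le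
          rw [Set.indicator_of_mem (Set.mem_Ioi.2 ht)]
          by_cases ht' : t ≤ R
          · rw [Set.indicator_of_mem (Set.mem_Ioc.2 ⟨ht, ht'⟩)]
            refine ENNReal.ofReal_le_ofReal (mul_le_of_le_one_right (by positivity) (hg.le_one _))
          · have : g (t • u) = 0 := by
              by_contra h0
              have := h _ h0
              rw [norm_smul, hu, mul_one, Real.norm_of_nonneg ht.le] at this
              exact ht' this
            rw [this, mul_zero, ENNReal.ofReal_zero]
            exact zero_le
      _ = ENNReal.ofReal (∫ t in Set.Ioc 0 R, p * t ^ (p - 1)) :=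
          (ofReal_integral_eq_lintegral_ofReal hint
            ((ae_restrict_iff' measurableSet_Ioc).2 (.of_forall hnn))).symm
      _ ≤ _ := ENNReal.ofReal_le_ofReal (by linarith)
  have := radialMoment_smul (p := p) (g := g) (‖x‖⁻¹ • x) hx'
  rw [smul_smul, mul_inv_cancel₀ hx'.ne', one_smul] at this
  rw [this, mul_comm _ (‖x‖ ^ (-p)), ENNReal.ofReal_mul (by positivity)]
  gcongr
  exact hu _ (by rw [norm_smul, norm_inv, norm_norm, inv_mul_cancel₀ hx'.ne'])

theorem radialMoment_lt_top (hp : 0 < p) {x : EuclideanSpace ℝ (Fin n)} (hx : x ≠ 0) :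
    radialMoment p g x < ⊤ := by
  obtain ⟨m, -, h⟩ := hg.radialMoment_le hp
  exact (h x hx).trans_lt ENNReal.ofReal_lt_top

theorem isBounded_ballBody (hp : 0 < p) : Bornology.IsBounded (ballBody p g) := by
  obtain ⟨m, hm, h⟩ := hg.radialMoment_le hp
  rw [isBounded_iff_forall_norm_le]
  refine ⟨m ^ p⁻¹, fun x hx => ?_⟩
  by_cases hx0 : x = 0
  · rw [hx0, norm_zero]; positivity
  have hx' : 0 < ‖x‖ := norm_pos_iff.2 hx0
  have := (hg.mem_ballBody.1 hx).trans (h x hx0)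
  rw [ENNReal.one_le_ofReal, Real.rpow_neg hx'.le, ← div_eq_mul_inv, one_le_div (by positivity)]
    at this
  rwa [Real.le_rpow_inv_iff_of_pos hx'.le hm.le hp]

/-- The moment has a positive lower bound on a ball of radius r; homogeneity raises it to 1 on a
smaller concentric ball. -/
theorem ballBody_mem_nhds_zero (hp : 0 < p) : ballBody p g ∈ nhds 0 := by
  obtain ⟨r, hr, c, hc, h⟩ := hg.exists_le
  have hm : 0 < ∫⁻ t in Set.Ioc (0 : ℝ) 1, ENNReal.ofReal (p * t ^ (p - 1) * c) := by
    rw [setLIntegral_pos_iff (by fun_prop)]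
    refine lt_of_lt_of_le (by simp) (measure_mono (μ := volume) (s := Set.Ioc (0 : ℝ) 1) ?_)
    intro t ht
    have := ht.1
    refine ⟨?_, ht⟩
    simp only [Function.mem_support, ne_eq, ENNReal.ofReal_eq_zero, not_le]
    positivity
  set m := ∫⁻ t in Set.Ioc (0 : ℝ) 1, ENNReal.ofReal (p * t ^ (p - 1) * c) with hmd
  have hlow : ∀ x : EuclideanSpace ℝ (Fin n), ‖x‖ ≤ r → m ≤ radialMoment p g x := by
    intro x hx
    rw [hmd, radialMoment]
    refine (setLIntegral_mono' measurableSet_Ioc fun t ht => ?_).trans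
      (lintegral_mono_set Set.Ioc_subset_Ioi_self)
    have := ht.1
    gcongr
    refine h _ ?_
    rw [norm_smul, Real.norm_of_nonneg this.le]
    exact (mul_le_of_le_one_left (norm_nonneg _) ht.2).trans hx
  obtain ⟨q, hq, hqm⟩ := ENNReal.lt_iff_exists_real_btwn.1 hm
  have hq0 : 0 < q := by simpa using hqm.1
  set ε := q ^ p⁻¹ with hε
  have hε0 : 0 < ε := by positivity
  refine Filter.mem_of_superset (Metric.ball_mem_nhds 0 (show 0 < ε * r by positivity)) ?_
  intro x hx
  rw [Metric.mem_ball, dist_zero_right] at hx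
  rw [hg.mem_ballBody]
  have := radialMoment_smul (p := p) (g := g) (ε⁻¹ • x) hε0
  rw [smul_smul, mul_inv_cancel₀ hε0.ne', one_smul] at this
  rw [this]
  have h1 : ENNReal.ofReal q ≤ radialMoment p g (ε⁻¹ • x) := by
    refine hqm.2.le.trans (hlow _ ?_)
    rw [norm_smul, norm_inv, Real.norm_of_nonneg hε0.le, inv_mul_le_iff₀ hε0]
    exact hx.le
  calc (1 : ENNReal) = ENNReal.ofReal (ε ^ (-p)) * ENNReal.ofReal q := by
        rw [← ENNReal.ofReal_mul (by positivity), Real.rpow_neg hε0.le, hε,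
          Real.rpow_inv_rpow hq hp.ne', inv_mul_cancel₀ hq0.ne', ENNReal.ofReal_one]
    _ ≤ _ := by gcongr

/-- A point x of the closure has gauge at most 1, so x/b lies in the body for every b > 1. By
homogeneity b^p times the moment of x is at least 1, and b tends to 1. -/
theorem isClosed_ballBody (hp : 0 < p) : IsClosed (ballBody p g) := by
  have h0 := hg.ballBody_mem_nhds_zero hp
  have hc := hg.convex_ballBody hp
  refine isClosed_of_closure_subset fun x hx => ?_
  rw [← gauge_le_one_iff_mem_closure hc h0] at hx
  have key : ∀ᶠ b in nhdsWithin (1 : ℝ) (Set.Ioi 1),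
      1 ≤ ENNReal.ofReal (b ^ p) * radialMoment p g x := by
    filter_upwards [self_mem_nhdsWithin] with b hb
    obtain ⟨c, hc0, hcb, y, hy, rfl⟩ := exists_lt_of_gauge_lt (absorbent_nhds_zero h0)
      (hx.trans_lt hb)
    have hb0 : 0 < b := hc0.trans hcb
    have hmem : b⁻¹ • c • y ∈ ballBody p g := by
      rw [smul_smul]
      exact hg.smul_mem_ballBody hp hy (by positivity) (by rw [inv_mul_le_iff₀ hb0]; linarith)
    rw [hg.mem_ballBody, radialMoment_smul _ (by positivity), Real.inv_rpow hb0.le,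
      Real.rpow_neg hb0.le, inv_inv] at hmem
    exact hmem
  rw [hg.mem_ballBody]
  by_cases hx0 : x = 0
  · exact hg.mem_ballBody.1 (hx0 ▸ mem_of_mem_nhds h0)
  have lim : Filter.Tendsto (fun b : ℝ => ENNReal.ofReal (b ^ p) * radialMoment p g x)
      (nhdsWithin 1 (Set.Ioi 1)) (nhds (ENNReal.ofReal (1 ^ p) * radialMoment p g x)) := by
    refine ENNReal.Tendsto.mul_const ?_ (Or.inr (hg.radialMoment_lt_top hp hx0).ne)
    exact ENNReal.tendsto_ofReal
      ((Real.continuousAt_rpow_const 1 p (Or.inr hp.le)).tendsto.mono_left nhdsWithin_le_nhds)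
  simpa using ge_of_tendsto lim key

/-- **Ball's theorem**: the Ball bodies of a log-concave density are convex bodies. -/
theorem isConvexBody_ballBody (hp : 0 < p) : IsConvexBody (ballBody p g) :=
  ⟨Metric.isCompact_of_isClosed_isBounded (hg.isClosed_ballBody hp) (hg.isBounded_ballBody hp),
    hg.convex_ballBody hp, ⟨0, mem_interior_iff_mem_nhds.2 (hg.ballBody_mem_nhds_zero hp)⟩⟩

end IsLogConcaveDensity

end BallBody

/-! ### Integration in polar coordinates over Ball's bodies -/

theorem lintegral_polar {n : ℕ} (hn : n ≠ 0) {F : EuclideanSpace ℝ (Fin n) → ENNReal}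
    (hF : Measurable F) : ∫⁻ x, F x =
      ∫⁻ ω, (∫⁻ t : ℝ in Set.Ioi 0, ENNReal.ofReal (t ^ (n - 1)) * F (t • (ω : EuclideanSpace ℝ (Fin n))))
        ∂(volume : Measure (EuclideanSpace ℝ (Fin n))).toSphere := by
  have : NeZero n := ⟨hn⟩
  have hm := (volume : Measure (EuclideanSpace ℝ (Fin n))).measurePreserving_homeomorphUnitSphereProd
  have e1 : ∫⁻ x, F x = ∫⁻ x : ({(0)}ᶜ : Set (EuclideanSpace ℝ (Fin n))), F x.1
      ∂(volume : Measure (EuclideanSpace ℝ (Fin n))).comap (↑) := by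
    rw [lintegral_subtype_comap (measurableSet_singleton _).compl, restrict_compl_singleton]
  have hF' : Measurable fun z : Metric.sphere (0 : EuclideanSpace ℝ (Fin n)) 1 × Set.Ioi (0 : ℝ) =>
      F ((z.2 : ℝ) • (z.1 : EuclideanSpace ℝ (Fin n))) :=
    hF.comp (by fun_prop)
  have e2 := hm.lintegral_comp_emb (Homeomorph.measurableEmbedding _)
    (fun z => F ((z.2 : ℝ) • (z.1 : EuclideanSpace ℝ (Fin n))))
  have e3 : ∀ x : ({(0)}ᶜ : Set (EuclideanSpace ℝ (Fin n))),
      F (((homeomorphUnitSphereProd _ x).2 : ℝ) •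
        ((homeomorphUnitSphereProd _ x).1 : EuclideanSpace ℝ (Fin n))) = F x.1 := by
    intro x
    have hx : ‖(x : EuclideanSpace ℝ (Fin n))‖ ≠ 0 := norm_ne_zero_iff.2 x.2
    simp [smul_smul, hx]
  simp_rw [e3] at e2
  rw [e1, e2, lintegral_prod _ hF'.aemeasurable]
  refine lintegral_congr fun ω => ?_
  have hFω : Measurable fun t : Set.Ioi (0 : ℝ) => F ((t : ℝ) • (ω : EuclideanSpace ℝ (Fin n))) :=
    hF.comp (by fun_prop)
  rw [Measure.volumeIoiPow, lintegral_withDensity_eq_lintegral_mul _ (by fun_prop) hFω,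
    finrank_euclideanSpace_fin]
  exact lintegral_subtype_comap (measurableSet_Ioi (a := (0 : ℝ))) (fun t : ℝ =>
    ENNReal.ofReal (t ^ (n - 1)) * F (t • (ω : EuclideanSpace ℝ (Fin n))))

theorem lintegral_Ioc_pow {N : ℕ} {m : ℝ} (hm : 0 ≤ m) :
    ∫⁻ t in Set.Ioc 0 m, ENNReal.ofReal (t ^ N) = ENNReal.ofReal (m ^ (N + 1) / (N + 1)) := by
  rw [← ofReal_integral_eq_lintegral_ofReal (intervalIntegral.intervalIntegrable_pow _).1,
    ← intervalIntegral.integral_of_le hm]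
  · simp
  · filter_upwards [ae_restrict_mem measurableSet_Ioc] with y hy
    exact pow_nonneg hy.1.le _

namespace IsLogConcaveDensity

variable {n : ℕ} {g : EuclideanSpace ℝ (Fin n) → ℝ} (hg : IsLogConcaveDensity g)
include hg

/-- The ray through x meets Ball's body in the parameters t ≤ m, where m^p is the radial moment of
x; and ∫₀^m t^(p-1) dt = m^p / p. -/
theorem lintegral_ray_ballBody {N : ℕ} {p : ℝ} (hp : p = N + 1) {x : EuclideanSpace ℝ (Fin n)}
    (hx : x ≠ 0) :
    ∫⁻ t in Set.Ioi 0, ENNReal.ofReal (t ^ N) *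
        (ballBody p g).indicator (fun _ => 1) (t • x) =
      ∫⁻ t in Set.Ioi 0, ENNReal.ofReal (t ^ N) * ENNReal.ofReal (g (t • x)) := by
  have hp0 : 0 < p := by rw [hp]; positivity
  have hfin := hg.radialMoment_lt_top hp0 hx
  set m := (radialMoment p g x).toReal ^ p⁻¹ with hm
  have hm0 : 0 ≤ m := by positivity
  have hmp : ENNReal.ofReal (m ^ p) = radialMoment p g x := by
    rw [hm, Real.rpow_inv_rpow ENNReal.toReal_nonneg hp0.ne', ENNReal.ofReal_toReal hfin.ne]
  have hmem : ∀ t : ℝ, 0 < t → (t • x ∈ ballBody p g ↔ t ≤ m) := by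
    intro t ht
    rw [hg.mem_ballBody, radialMoment_smul _ ht, ← hmp, ← ENNReal.ofReal_mul (by positivity),
      ENNReal.one_le_ofReal, Real.rpow_neg ht.le, ← div_eq_inv_mul, one_le_div (by positivity),
      Real.rpow_le_rpow_iff ht.le hm0 hp0]
  have lhs : ∫⁻ t in Set.Ioi 0, ENNReal.ofReal (t ^ N) *
      (ballBody p g).indicator (fun _ => 1) (t • x) =
      ∫⁻ t in Set.Ioc 0 m, ENNReal.ofReal (t ^ N) := by
    rw [← lintegral_indicator measurableSet_Ioi, ← lintegral_indicator measurableSet_Ioc]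
    refine lintegral_congr fun t => ?_
    by_cases ht : 0 < t
    · rw [Set.indicator_of_mem (Set.mem_Ioi.2 ht)]
      by_cases htm : t ≤ m
      · rw [Set.indicator_of_mem (Set.mem_Ioc.2 ⟨ht, htm⟩),
          Set.indicator_of_mem ((hmem t ht).2 htm), mul_one]
      · rw [Set.indicator_of_notMem (fun h => htm (Set.mem_Ioc.1 h).2),
          Set.indicator_of_notMem (fun h => htm ((hmem t ht).1 h)), mul_zero]
    · rw [Set.indicator_of_notMem (fun h => ht (Set.mem_Ioi.1 h)),
        Set.indicator_of_notMem (fun h => ht (Set.mem_Ioc.1 h).1)]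
  have hpow : m ^ (N + 1) = m ^ p := by
    rw [hp, ← Nat.cast_add_one, Real.rpow_natCast]
  rw [lhs, lintegral_Ioc_pow hm0, hpow, ← hp, div_eq_inv_mul, ENNReal.ofReal_mul (by positivity),
    hmp, radialMoment, ← lintegral_const_mul' _ _ ENNReal.ofReal_ne_top]
  refine setLIntegral_congr_fun measurableSet_Ioi fun t ht => ?_
  have ht' : (0 : ℝ) < t := ht
  have := hg.nonneg (t • x)
  rw [← ENNReal.ofReal_mul (by positivity), ← ENNReal.ofReal_mul (by positivity)]
  congr 1
  rw [← mul_assoc, ← mul_assoc, inv_mul_cancel₀ hp0.ne', one_mul, hp, add_sub_cancel_right,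
    Real.rpow_natCast]

/-- Integrals of homogeneous functions over Ball's bodies. -/
theorem lintegral_ballBody (hn : n ≠ 0) {d : ℕ} {p : ℝ} (hp : p = n + d)
    {q : EuclideanSpace ℝ (Fin n) → ENNReal} (hq : Measurable q)
    (hhom : ∀ t : ℝ, 0 < t → ∀ x, q (t • x) = ENNReal.ofReal (t ^ d) * q x) :
    ∫⁻ x in ballBody p g, q x = ∫⁻ x, q x * ENNReal.ofReal (g x) := by
  have hp0 : 0 < p := by rw [hp]; positivity
  have hT : MeasurableSet (ballBody p g) := (hg.isClosed_ballBody hp0).measurableSet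
  rw [← lintegral_indicator hT, lintegral_polar hn (hq.indicator hT),
    lintegral_polar hn (F := fun x => q x * ENNReal.ofReal (g x))
      (hq.mul hg.measurable.ennreal_ofReal)]
  refine lintegral_congr fun ω => ?_
  have hω : (ω : EuclideanSpace ℝ (Fin n)) ≠ 0 := by
    intro h0
    have := ω.2
    rw [mem_sphere_zero_iff_norm, h0, norm_zero] at this
    exact zero_ne_one this
  have hN : p = (n - 1 + d : ℕ) + 1 := by
    rw [hp, ← Nat.cast_add_one, ← Nat.cast_add]; congr 1; omega
  have key := hg.lintegral_ray_ballBody hN hω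
  -- Homogeneity of `q` turns the polar weight t^(n-1) into t^(n+d-1), the weight belonging to p = n
  -- + d.
  have pull (F : ℝ → ENNReal) (hF : Measurable F) :
      ∫⁻ t in Set.Ioi 0, ENNReal.ofReal (t ^ (n - 1)) *
          (q (t • (ω : EuclideanSpace ℝ (Fin n))) * F t) =
        q ω * ∫⁻ t in Set.Ioi 0, ENNReal.ofReal (t ^ (n - 1 + d)) * F t := by
    have hm : Measurable fun t : ℝ => ENNReal.ofReal (t ^ (n - 1 + d)) * F t :=
      Measurable.mul (by fun_prop) hF
    rw [← lintegral_const_mul _ hm]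
    refine setLIntegral_congr_fun measurableSet_Ioi fun t ht => ?_
    have ht' : (0 : ℝ) < t := ht
    rw [hhom t ht', pow_add, ENNReal.ofReal_mul (by positivity)]
    ring
  have hsm : Measurable fun t : ℝ => t • (ω : EuclideanSpace ℝ (Fin n)) := by fun_prop
  rw [pull _ (hg.measurable_smul _).ennreal_ofReal, ← key,
    ← pull (fun t => (ballBody p g).indicator (fun _ => 1) (t • (ω : EuclideanSpace ℝ (Fin n))))
      ((measurable_const.indicator hT).comp hsm)]
  refine lintegral_congr fun t => ?_
  congr 1
  by_cases h : t • (ω : EuclideanSpace ℝ (Fin n)) ∈ ballBody p g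
  · rw [Set.indicator_of_mem h, Set.indicator_of_mem h, mul_one]
  · rw [Set.indicator_of_notMem h, Set.indicator_of_notMem h, mul_zero]

end IsLogConcaveDensity

/-! ### Comparison of moments for profiles with a concave root -/

theorem integral_pow_mul_one_sub_pow (k n : ℕ) :
    ∫ u in (0 : ℝ)..1, u ^ k * (1 - u) ^ n = k.factorial * n.factorial / (k + n + 1).factorial := by
  induction n generalizing k with
  | zero =>
    simp only [pow_zero, mul_one, integral_pow, Nat.factorial_zero, Nat.cast_one, add_zero,
      Nat.factorial_succ]
    have := Nat.cast_ne_zero (R := ℝ).2 k.factorial_ne_zero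
    push_cast
    field_simp
    simp
  | succ n ih =>
    -- Integration by parts: u^(k+1) (1-u)^(n+1) vanishes at both ends.
    have h := intervalIntegral.integral_eq_sub_of_hasDerivAt (a := (0 : ℝ)) (b := 1)
      (f := fun u : ℝ => u ^ (k + 1) * (1 - u) ^ (n + 1))
      (f' := fun u : ℝ => (k + 1) * (u ^ k * (1 - u) ^ (n + 1)) -
        (n + 1) * (u ^ (k + 1) * (1 - u) ^ n))
      (fun u _ => by
        have h1 := (hasDerivAt_pow (k + 1) u).mul (((hasDerivAt_id u).const_sub 1).pow (n + 1))
        refine h1.congr_deriv ?_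
        simp only [Nat.add_sub_cancel, id, Pi.pow_apply]
        push_cast
        ring)
      (Continuous.intervalIntegrable (by fun_prop) _ _)
    rw [intervalIntegral.integral_sub (Continuous.intervalIntegrable (by fun_prop) _ _)
      (Continuous.intervalIntegrable (by fun_prop) _ _), intervalIntegral.integral_const_mul,
      intervalIntegral.integral_const_mul, ih (k + 1)] at h
    have e : k + 1 + n + 1 = k + (n + 1) + 1 := by ring
    rw [e] at h
    have h0 : ((k + (n + 1) + 1).factorial : ℝ) ≠ 0 :=
      Nat.cast_ne_zero.2 (Nat.factorial_ne_zero _)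
    have hk : (k + 1 : ℝ) ≠ 0 := by positivity
    rw [eq_div_iff h0]
    simp only [Nat.factorial_succ k, Nat.factorial_succ n] at h ⊢
    push_cast at h ⊢
    field_simp at h
    apply mul_left_cancel₀ hk
    simp only [one_pow, sub_self, zero_pow (Nat.succ_ne_zero _), mul_zero, zero_mul] at h
    linear_combination h

/-- The profile `t ↦ (1 - t / s)₊ⁿ`. -/
noncomputable def coneProfile (n : ℕ) (s t : ℝ) : ℝ := max 0 (1 - t / s) ^ n

theorem coneProfile_nonneg (n : ℕ) (s t : ℝ) : 0 ≤ coneProfile n s t :=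
  pow_nonneg (le_max_left _ _) n

theorem continuous_coneProfile (n : ℕ) (s : ℝ) : Continuous (coneProfile n s) := by
  unfold coneProfile; fun_prop

theorem coneProfile_le_one (n : ℕ) {s t : ℝ} (hs : 0 < s) (ht : 0 ≤ t) : coneProfile n s t ≤ 1 :=
  pow_le_one₀ (le_max_left _ _) (max_le zero_le_one (by have := div_nonneg ht hs.le; linarith))

theorem coneProfile_eq_zero {n : ℕ} (hn : n ≠ 0) {s t : ℝ} (hs : 0 < s) (ht : s ≤ t) :
    coneProfile n s t = 0 := by
  have : 1 ≤ t / s := (one_le_div hs).2 ht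
  rw [coneProfile, max_eq_left (by linarith), zero_pow hn]

theorem coneProfile_rpow_inv {n : ℕ} (hn : n ≠ 0) (s t : ℝ) :
    coneProfile n s t ^ (n : ℝ)⁻¹ = max 0 (1 - t / s) :=
  Real.pow_rpow_inv_natCast (le_max_left _ _) hn

theorem integral_pow_mul_coneProfile {n : ℕ} (hn : n ≠ 0) (k : ℕ) {s : ℝ} (hs : 0 < s) :
    ∫ t in Set.Ioi 0, t ^ k * coneProfile n s t =
      s ^ (k + 1) * (k.factorial * n.factorial / (k + n + 1).factorial) := by
  rw [setIntegral_eq_of_subset_of_forall_sdiff_eq_zero (s := Set.Ioc 0 s)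
    (f := fun t => t ^ k * coneProfile n s t) measurableSet_Ioi
    Set.Ioc_subset_Ioi_self (fun t ht => by
      rw [coneProfile_eq_zero hn hs, mul_zero]
      by_contra! h
      exact ht.2 ⟨ht.1, h.le⟩), ← intervalIntegral.integral_of_le hs.le,
    ← integral_pow_mul_one_sub_pow]
  have := intervalIntegral.integral_comp_mul_left (a := 0) (b := 1)
    (fun t => t ^ k * coneProfile n s t) hs.ne'
  rw [mul_zero, mul_one, eq_inv_smul_iff₀ hs.ne'] at this
  rw [← this, smul_eq_mul, pow_succ', mul_assoc, ← intervalIntegral.integral_const_mul (s ^ k)]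
  refine congrArg (s * ·) (intervalIntegral.integral_congr fun u hu => ?_)
  rw [Set.uIcc_of_le zero_le_one] at hu
  rw [coneProfile, mul_div_cancel_left₀ _ hs.ne', max_eq_right (by linarith [hu.2])]
  ring

theorem integrableOn_pow_mul_of_bounded {φ : ℝ → ℝ} (hm : Measurable φ) {R : ℝ}
    (h0 : ∀ t, 0 < t → 0 ≤ φ t) (h1 : ∀ t, 0 < t → φ t ≤ 1) (hR : ∀ t, 0 < t → R < t → φ t = 0)
    (k : ℕ) : IntegrableOn (fun t => t ^ k * φ t) (Set.Ioi 0) := by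
  refine IntegrableOn.of_forall_sdiff_eq_zero (s := Set.Ioc 0 R) ?_ measurableSet_Ioi (fun t ht => by
      rw [hR t ht.1, mul_zero]
      by_contra! h
      exact ht.2 ⟨ht.1, h⟩)
  have hb : IntegrableOn (fun t : ℝ => t ^ k) (Set.Ioc 0 R) :=
    (intervalIntegral.intervalIntegrable_pow k).1
  refine Integrable.mono' hb (by fun_prop) ?_
  filter_upwards [ae_restrict_mem measurableSet_Ioc] with t ht
  have := h0 t ht.1
  have := ht.1
  rw [Real.norm_of_nonneg (by positivity)]
  exact mul_le_of_le_one_right (by positivity) (h1 t ht.1)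

/-- Functions on the half-line of the form `t ↦ |K ∩ (tx + K)|` for a convex body `K ⊆ ℝⁿ` of
volume `1`. -/
structure IsRootConcaveProfile (n : ℕ) (f : ℝ → ℝ) : Prop where
  measurable : Measurable f
  nonneg : ∀ t, 0 ≤ f t
  le_one : ∀ t, f t ≤ 1
  exists_pos : ∃ r > 0, 0 < f r
  exists_bound : ∃ R > 0, ∀ t, R < t → f t = 0
  le_rpow : ∀ s t, 0 < s → s < t → f t ≠ 0 →
    1 - s / t + s / t * f t ^ (n : ℝ)⁻¹ ≤ f s ^ (n : ℝ)⁻¹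

namespace IsRootConcaveProfile

variable {n : ℕ} {f : ℝ → ℝ} (hf : IsRootConcaveProfile n f)
include hf

theorem pos_of_lt {s t : ℝ} (hn : n ≠ 0) (hs : 0 < s) (hst : s < t) (ht : f t ≠ 0) : 0 < f s := by
  have h := hf.le_rpow s t hs hst ht
  have h1 : s / t < 1 := (div_lt_one (hs.trans hst)).2 hst
  have h2 : 0 ≤ s / t * f t ^ (n : ℝ)⁻¹ :=
    mul_nonneg (div_nonneg hs.le (hs.trans hst).le) (Real.rpow_nonneg (hf.nonneg t) _)
  refine lt_of_le_of_ne (hf.nonneg s) fun h0 => ?_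
  rw [← h0, Real.zero_rpow (by positivity)] at h
  linarith

theorem antitone {s t : ℝ} (hn : n ≠ 0) (hs : 0 < s) (hst : s < t) : f t ≤ f s := by
  by_cases ht : f t = 0
  · rw [ht]; exact hf.nonneg s
  have h := hf.le_rpow s t hs hst ht
  have h1 : s / t < 1 := (div_lt_one (hs.trans hst)).2 hst
  have h2 : f t ^ (n : ℝ)⁻¹ ≤ 1 := Real.rpow_le_one (hf.nonneg t) (hf.le_one t) (by positivity)
  rw [← Real.rpow_le_rpow_iff (hf.nonneg t) (hf.nonneg s)
    (show 0 < (n : ℝ)⁻¹ by have := Nat.pos_of_ne_zero hn; positivity)]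
  nlinarith

/-- Both n-th roots start from the value 1 at 0. The root of f lies above its chord over [0, t],
while that of the cone is linear until it reaches 0; so f, once above the cone at t, is above it at
all earlier points. -/
theorem coneProfile_lt_of_lt {r s t : ℝ} (hn : n ≠ 0) (hs : 0 < s) (hst : s < t)
    (ht : coneProfile n r t < f t) : coneProfile n r s < f s := by
  have ht0 := hs.trans hst
  have hn' : 0 < (n : ℝ)⁻¹ := by have := Nat.pos_of_ne_zero hn; positivity
  have h := hf.le_rpow s t hs hst ((coneProfile_nonneg n r t).trans_lt ht).ne'
  have h1 : s / t < 1 := (div_lt_one ht0).2 hst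
  have h0 : 0 < s / t := by positivity
  rw [← Real.rpow_lt_rpow_iff (coneProfile_nonneg n r t) (hf.nonneg t) hn',
    coneProfile_rpow_inv hn] at ht
  rw [← Real.rpow_lt_rpow_iff (coneProfile_nonneg n r s) (hf.nonneg s) hn',
    coneProfile_rpow_inv hn]
  refine max_lt ?_ ?_
  · nlinarith [le_max_left 0 (1 - t / r)]
  · have h2 : 1 - t / r < f t ^ (n : ℝ)⁻¹ := (le_max_right _ _).trans_lt ht
    have h3 : s / t * (1 - t / r) = s / t - s / r := by field_simp
    nlinarith

theorem integrableOn (k : ℕ) : IntegrableOn (fun t => t ^ k * f t) (Set.Ioi 0) := by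
  obtain ⟨R, -, hR⟩ := hf.exists_bound
  exact integrableOn_pow_mul_of_bounded hf.measurable (fun t _ => hf.nonneg t)
    (fun t _ => hf.le_one t) (fun t _ h => hR t h) k

theorem integral_pos (hn : n ≠ 0) (k : ℕ) : 0 < ∫ t in Set.Ioi 0, t ^ k * f t := by
  obtain ⟨r, hr, hfr⟩ := hf.exists_pos
  rw [setIntegral_pos_iff_support_of_nonneg_ae _ (hf.integrableOn k)]
  · refine lt_of_lt_of_le (?_ : 0 < volume (Set.Ioo 0 r)) (measure_mono fun t ht => ⟨?_, ht.1⟩)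
    · simpa using hr
    · have h1 := hf.pos_of_lt hn ht.1 ht.2 hfr.ne'
      have h2 := ht.1
      rw [Function.mem_support]
      positivity
  · filter_upwards [ae_restrict_mem measurableSet_Ioi] with t ht
    exact mul_nonneg (pow_nonneg (le_of_lt ht) _) (hf.nonneg t)

/-- Equality of the lower moments removes the c² term, so c may be put at the crossing point, which
gives the integrand a constant sign. -/
theorem integral_weighted_sub (hn : n ≠ 0) {s : ℝ} (hs : 0 < s)
    (hm : ∫ t in Set.Ioi 0, t ^ (n - 1) * f t = ∫ t in Set.Ioi 0, t ^ (n - 1) * coneProfile n s t)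
    (c : ℝ) :
    ∫ t in Set.Ioi 0, t ^ (n - 1) * ((f t - coneProfile n s t) * (c ^ 2 - t ^ 2)) =
      (∫ t in Set.Ioi 0, t ^ (n + 1) * coneProfile n s t) - ∫ t in Set.Ioi 0, t ^ (n + 1) * f t := by
  have hn1 : n + 1 = n - 1 + 2 := by omega
  have hℓ (k : ℕ) : IntegrableOn (fun t => t ^ k * coneProfile n s t) (Set.Ioi 0) :=
    integrableOn_pow_mul_of_bounded (continuous_coneProfile n s).measurable
      (fun t _ => coneProfile_nonneg n s t) (fun t ht => coneProfile_le_one n hs ht.le)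
      (fun t _ h => coneProfile_eq_zero hn hs h.le) k
  have e : ∀ t : ℝ, t ^ (n - 1) * ((f t - coneProfile n s t) * (c ^ 2 - t ^ 2)) =
      (c ^ 2 * (t ^ (n - 1) * f t) - c ^ 2 * (t ^ (n - 1) * coneProfile n s t)) +
        (t ^ (n + 1) * coneProfile n s t - t ^ (n + 1) * f t) := by
    intro t
    rw [hn1, pow_add]
    ring
  simp_rw [e]
  have i1 : IntegrableOn (fun t => c ^ 2 * (t ^ (n - 1) * f t) -
      c ^ 2 * (t ^ (n - 1) * coneProfile n s t)) (Set.Ioi 0) :=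
    ((hf.integrableOn _).const_mul _).sub ((hℓ _).const_mul _)
  have i2 : IntegrableOn (fun t => t ^ (n + 1) * coneProfile n s t - t ^ (n + 1) * f t)
      (Set.Ioi 0) := (hℓ _).sub (hf.integrableOn _)
  rw [integral_add i1 i2, integral_sub ((hf.integrableOn _).const_mul _)
    ((hℓ _).const_mul _), integral_sub (hℓ _) (hf.integrableOn _), integral_const_mul,
    integral_const_mul, hm, sub_self, zero_add]

/-- The point at which a profile crosses the cone profile with the same moment of order `n`. -/
theorem exists_crossing (hn : n ≠ 0) (s : ℝ) : ∃ c : ℝ, ∀ t, 0 < t →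
    0 ≤ (f t - coneProfile n s t) * (c ^ 2 - t ^ 2) ∧
      ((f t - coneProfile n s t) * (c ^ 2 - t ^ 2) = 0 → t ≠ c → f t = coneProfile n s t) := by
  obtain ⟨R, hR0, hR⟩ := hf.exists_bound
  set U := {t | 0 < t ∧ coneProfile n s t < f t} with hU
  have hbdd : BddAbove U := ⟨R, fun t ht => by
    by_contra! h
    have := ht.2
    rw [hR t h] at this
    exact absurd this (not_lt.2 (coneProfile_nonneg n s t))⟩
  have hc0 : 0 ≤ sSup U := Real.sSup_nonneg fun t ht => ht.1.le
  -- The crossing point is the supremum of the set where f exceeds the cone. If that set is empty,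
  -- the supremum is 0 by convention and f stays below the cone on the whole half-line.
  refine ⟨sSup U, fun t ht => ⟨?_, fun h0 htc => ?_⟩⟩
  · rcases lt_trichotomy t (sSup U) with h | h | h
    · have hne : U.Nonempty := by
        by_contra hne
        rw [Set.not_nonempty_iff_eq_empty] at hne
        rw [hne, Real.sSup_empty] at h
        linarith
      obtain ⟨t', ht', htt'⟩ := exists_lt_of_lt_csSup hne h
      have := hf.coneProfile_lt_of_lt hn ht htt' ht'.2
      exact mul_nonneg (by linarith) (by nlinarith)
    · rw [h, sub_self, mul_zero]
    · have : f t ≤ coneProfile n s t := by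
        by_contra! hlt
        exact absurd (le_csSup hbdd ⟨ht, hlt⟩) (not_le.2 h)
      exact mul_nonneg_of_nonpos_of_nonpos (by linarith) (by nlinarith)
  · rcases mul_eq_zero.1 h0 with h | h
    · linarith
    · exact absurd ((pow_left_inj₀ hc0 ht.le two_ne_zero).1 (by linarith)) htc.symm

/-- **Berwald's inequality** for the moments of orders `n` and `n + 2`, with its equality case. -/
theorem integral_le_coneProfile (hn : n ≠ 0) {s : ℝ} (hs : 0 < s)
    (hm : ∫ t in Set.Ioi 0, t ^ (n - 1) * f t =
      ∫ t in Set.Ioi 0, t ^ (n - 1) * coneProfile n s t) :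
    ∫ t in Set.Ioi 0, t ^ (n + 1) * f t ≤ ∫ t in Set.Ioi 0, t ^ (n + 1) * coneProfile n s t ∧
    (∫ t in Set.Ioi 0, t ^ (n + 1) * f t = ∫ t in Set.Ioi 0, t ^ (n + 1) * coneProfile n s t →
      ∀ t, 0 < t → f t = coneProfile n s t) := by
  obtain ⟨c, hc⟩ := hf.exists_crossing hn s
  have hint := hf.integral_weighted_sub hn hs hm c
  have hnn : 0 ≤ᵐ[volume.restrict (Set.Ioi (0 : ℝ))] fun t =>
      t ^ (n - 1) * ((f t - coneProfile n s t) * (c ^ 2 - t ^ 2)) := by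
    filter_upwards [ae_restrict_mem measurableSet_Ioi] with t ht
    exact mul_nonneg (pow_nonneg (le_of_lt ht) _) (hc t ht).1
  have h0 := integral_nonneg_of_ae hnn
  refine ⟨by linarith, fun heq => ?_⟩
  have hi : Integrable (fun t => t ^ (n - 1) * ((f t - coneProfile n s t) * (c ^ 2 - t ^ 2)))
      (volume.restrict (Set.Ioi (0 : ℝ))) := by
    have hℓ (k : ℕ) : IntegrableOn (fun t => t ^ k * coneProfile n s t) (Set.Ioi 0) :=
      integrableOn_pow_mul_of_bounded (continuous_coneProfile n s).measurable
        (fun t _ => coneProfile_nonneg n s t) (fun t ht => coneProfile_le_one n hs ht.le)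
        (fun t _ h => coneProfile_eq_zero hn hs h.le) k
    refine ((((hf.integrableOn (n - 1)).sub (hℓ (n - 1))).const_mul (c ^ 2)).sub
      ((hf.integrableOn (n + 1)).sub (hℓ (n + 1)))).congr (.of_forall fun t => ?_)
    have hn1 : n + 1 = n - 1 + 2 := by omega
    simp only [Pi.sub_apply]
    rw [hn1, pow_add]
    ring
  rw [heq, sub_self, integral_eq_zero_iff_of_nonneg_ae hnn hi] at hint
  have hae : ∀ᵐ t ∂volume.restrict (Set.Ioi (0 : ℝ)), f t = coneProfile n s t := by
    filter_upwards [hint, ae_restrict_mem measurableSet_Ioi,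
      (measure_eq_zero_iff_ae_notMem.1 (measure_singleton (μ := volume.restrict (Set.Ioi (0 : ℝ))) c))]
      with t h1 ht htc
    have ht' : (0 : ℝ) < t := ht
    exact (hc t ht).2 ((mul_eq_zero.1 h1).resolve_left (by positivity)) htc
  -- Almost everywhere equality gives equality on a dense set. Continuity of f is not available, so
  -- monotonicity replaces it in the passage to every point.
  have hdense : ∀ a b : ℝ, 0 ≤ a → a < b → ∃ t ∈ Set.Ioo a b, f t = coneProfile n s t := by
    intro a b ha hab
    by_contra! hne
    rw [ae_restrict_iff' measurableSet_Ioi, ae_iff] at hae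
    have : 0 < volume (Set.Ioo a b) := by simpa using hab
    refine this.ne' (measure_mono_null (fun t ht => ?_) hae)
    simp only [Set.mem_ofPred_eq, Set.mem_Ioi, Classical.not_imp]
    exact ⟨ha.trans_lt ht.1, hne t ht⟩
  intro t ht
  rcases lt_trichotomy (f t) (coneProfile n s t) with h | h | h
  -- By continuity the cone still exceeds f(t) slightly to the right of t, where f is at most f(t);
  -- this contradicts equality at a nearby point.
  · exfalso
    have hev := ((continuous_coneProfile n s).tendsto t).eventually_const_lt h
    obtain ⟨ε, hε, hball⟩ := Metric.eventually_nhds_iff.1 hev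
    obtain ⟨u, hu, hfu⟩ := hdense t (t + ε) ht.le (by linarith)
    have h1 := hball (y := u) (by rw [Real.dist_eq, abs_lt]; constructor <;> linarith [hu.1, hu.2])
    have h2 := hf.antitone hn ht hu.1
    linarith
  · exact h
  -- If f exceeds the cone at t, it does so on all of (0, t), which contains a point of equality.
  · exfalso
    obtain ⟨u, hu, hfu⟩ := hdense 0 t le_rfl ht
    have := hf.coneProfile_lt_of_lt hn hu.1 hu.2 h
    linarith

end IsRootConcaveProfile

/-! ### The volume of Ball's body of order `n + 2` of the covariogram -/

/-- The open set int B \ A is null, hence empty, and B is contained in the closure of its interior.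
-/
theorem eq_of_subset_of_volume_eq {n : ℕ} {A B : Set (EuclideanSpace ℝ (Fin n))}
    (hA : IsClosed A) (hB : IsConvexBody B) (hAB : A ⊆ B) (h : volume B ≤ volume A) : A = B := by
  have hfin : volume A ≠ ⊤ := ((measure_mono hAB).trans_lt hB.1.measure_lt_top).ne
  have h0 : volume (interior B \ A) = 0 := by
    refine measure_mono_null (Set.sdiff_subset_sdiff_left interior_subset) ?_
    rw [measure_sdiff hAB hA.measurableSet.nullMeasurableSet hfin, tsub_eq_zero_of_le h]
  have h1 : interior B \ A = ∅ :=
    ((isOpen_interior.sdiff hA).measure_eq_zero_iff volume).1 h0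
  refine hAB.antisymm ?_
  calc B ⊆ closure (interior B) := by
        rw [hB.2.1.closure_interior_eq_closure_of_nonempty_interior hB.2.2]; exact subset_closure
    _ ⊆ A := hA.closure_subset_iff.2 (Set.sdiff_eq_empty.1 h1)

theorem radialMoment_natCast {n : ℕ} {g : EuclideanSpace ℝ (Fin n) → ℝ}
    {x : EuclideanSpace ℝ (Fin n)} {k : ℕ} {p : ℝ} (hp : p = k + 1) (hg : ∀ x, 0 ≤ g x)
    (hi : IntegrableOn (fun t : ℝ => t ^ k * g (t • x)) (Set.Ioi 0)) :
    radialMoment p g x = ENNReal.ofReal ((k + 1) * ∫ t in Set.Ioi 0, t ^ k * g (t • x)) := by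
  rw [← integral_const_mul, ofReal_integral_eq_lintegral_ofReal (hi.const_mul _), radialMoment]
  · refine setLIntegral_congr_fun measurableSet_Ioi fun t ht => ?_
    rw [hp, add_sub_cancel_right, Real.rpow_natCast, mul_assoc]
  · filter_upwards [ae_restrict_mem measurableSet_Ioi] with t ht
    have ht' : (0 : ℝ) < t := ht
    have := hg (t • x)
    simp only [Pi.zero_apply]
    positivity

/-- Tonelli and the substitution z = y - x: for independent uniform points of a body of volume 1,
g_K is the density of their difference. -/
theorem lintegral_covariogram {n : ℕ} {K : Set (EuclideanSpace ℝ (Fin n))} (hK : IsCompact K)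
    {q : EuclideanSpace ℝ (Fin n) → ENNReal} (hq : Measurable q) :
    ∫⁻ x, q x * ENNReal.ofReal (covariogram K x) = ∫⁻ y in K, ∫⁻ z in K, q (y - z) := by
  have hKm := hK.measurableSet
  have e1 : ∀ x, q x * ENNReal.ofReal (covariogram K x) =
      ∫⁻ y, K.indicator 1 y * (K.indicator 1 (y - x) * q x) := by
    intro x
    rw [covariogram_eq, ofReal_measureReal (isCompact_inter_sub_mem hK x).measure_lt_top.ne,
      ← lintegral_indicator_one (isCompact_inter_sub_mem hK x).measurableSet,
      ← lintegral_const_mul _ (measurable_one.indicator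
        (isCompact_inter_sub_mem hK x).measurableSet)]
    refine lintegral_congr fun y => ?_
    by_cases h1 : y ∈ K <;> by_cases h2 : y - x ∈ K <;> simp [h1, h2, Set.indicator]
  simp_rw [e1]
  have hi : Measurable (K.indicator (1 : EuclideanSpace ℝ (Fin n) → ENNReal)) :=
    measurable_one.indicator hKm
  rw [lintegral_lintegral_swap (Measurable.aemeasurable ((hi.comp measurable_snd).mul
    ((hi.comp (measurable_snd.sub measurable_fst)).mul (hq.comp measurable_fst)))),
    ← lintegral_indicator hKm]
  refine lintegral_congr fun y => ?_
  by_cases hy : y ∈ K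
  · simp only [Set.indicator_of_mem hy, Pi.one_apply, one_mul]
    rw [← lintegral_indicator hKm, ← lintegral_sub_left_eq_self _ y]
    refine lintegral_congr fun z => ?_
    by_cases hz : z ∈ K <;> simp [hz]
  · simp [hy]

section

variable {n : ℕ} {K : Set (EuclideanSpace ℝ (Fin n))}

theorem isRootConcaveProfile_covariogram (hn : n ≠ 0) (hK : IsConvexBody K) (h1 : volume K = 1)
    {x : EuclideanSpace ℝ (Fin n)} (hx : x ≠ 0) :
    IsRootConcaveProfile n fun t => covariogram K (t • x) := by
  have hg := isLogConcaveDensity_covariogram hK h1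
  have hx' : 0 < ‖x‖ := norm_pos_iff.2 hx
  refine ⟨hg.measurable_smul x, fun t => hg.nonneg _, fun t => hg.le_one _, ?_, ?_, ?_⟩
  · obtain ⟨r, hr, c, hc, h⟩ := hg.exists_le
    refine ⟨r / ‖x‖, by positivity, hc.trans_le (h _ ?_)⟩
    rw [norm_smul, norm_div, norm_norm, Real.norm_of_nonneg hr.le, div_mul_cancel₀ _ hx'.ne']
  · obtain ⟨R, hR, h⟩ := hg.exists_norm_le
    refine ⟨R / ‖x‖, by positivity, fun t ht => ?_⟩
    by_contra h0
    have h2 := h _ h0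
    rw [norm_smul, Real.norm_eq_abs] at h2
    rw [div_lt_iff₀ hx'] at ht
    have := le_abs_self t
    nlinarith
  · intro s t hs hst ht
    have ht0 := hs.trans hst
    have h := covariogram_root_concave hn hK.1 hK.2.1 (x := 0) (y := t • x)
      (by rw [hg.zero_eq]; exact one_ne_zero) ht (a := 1 - s / t) (b := s / t)
      (by rw [sub_pos, div_lt_one ht0]; exact hst) (by positivity) (by ring)
    rwa [hg.zero_eq, Real.one_rpow, mul_one, smul_zero, zero_add, smul_smul,
      div_mul_cancel₀ _ ht0.ne'] at h

/-- The cone of extent s has radial moment sⁿ n B(n, n+1) of order n and s^(n+2) (n+2) B(n+2, n+1)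
of order n + 2; these Beta values produce the binomial coefficients of D_n. -/
theorem pred_mul_beta_eq (hn : n ≠ 0) :
    (n : ℝ) * ((n - 1).factorial * n.factorial / (n - 1 + n + 1).factorial) =
      ((2 * n).choose n : ℝ)⁻¹ := by
  rw [show n - 1 + n + 1 = n + n by omega, two_mul, Nat.add_choose, Nat.cast_div
    (Nat.factorial_mul_factorial_dvd_factorial_add n n) (by positivity)]
  have : (n : ℝ) * (n - 1).factorial = n.factorial := by
    rw [← Nat.cast_mul, Nat.mul_factorial_pred hn]
  push_cast
  rw [inv_div, ← mul_div_assoc, ← mul_assoc, this]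

theorem succ_mul_beta_eq (n : ℕ) :
    ((n + 1 : ℕ) + 1 : ℝ) * ((n + 1).factorial * n.factorial / (n + 1 + n + 1).factorial) =
      ((2 * n + 2).choose n : ℝ)⁻¹ := by
  rw [show 2 * n + 2 = n + 2 + n by ring, Nat.add_choose, Nat.cast_div
    (Nat.factorial_mul_factorial_dvd_factorial_add (n + 2) n) (by positivity),
    show n + 1 + n + 1 = n + 2 + n by ring, Nat.factorial_succ (n + 1)]
  push_cast
  rw [inv_div]
  ring

theorem radialMoment_covariogram_of_eq_coneProfile (hn : n ≠ 0) (hK : IsConvexBody K)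
    (h1 : volume K = 1) {x : EuclideanSpace ℝ (Fin n)} (hx : x ≠ 0) {s : ℝ} (hs : 0 < s)
    (h : ∀ t, 0 < t → covariogram K (t • x) = coneProfile n s t) :
    radialMoment n (covariogram K) x = ENNReal.ofReal (s ^ n / (2 * n).choose n) ∧
      radialMoment ((n : ℝ) + 2) (covariogram K) x =
        ENNReal.ofReal (s ^ (n + 2) / (2 * n + 2).choose n) := by
  have hf := isRootConcaveProfile_covariogram hn hK h1 hx
  have hn' : ((n - 1 : ℕ) : ℝ) + 1 = n := by
    rw [← Nat.cast_add_one]; congr 1; omega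
  have e (k : ℕ) : ∫ t in Set.Ioi 0, t ^ k * covariogram K (t • x) =
      ∫ t in Set.Ioi 0, t ^ k * coneProfile n s t :=
    setIntegral_congr_fun measurableSet_Ioi fun t ht => by rw [h t ht]
  constructor
  · rw [radialMoment_natCast (k := n - 1) hn'.symm (covariogram_nonneg K) (hf.integrableOn _), e,
      integral_pow_mul_coneProfile hn _ hs, hn', mul_left_comm, pred_mul_beta_eq hn,
      Nat.sub_add_cancel (Nat.one_le_iff_ne_zero.2 hn), div_eq_mul_inv]
  · rw [radialMoment_natCast (k := n + 1) (by push_cast; ring) (covariogram_nonneg K)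
      (hf.integrableOn _), e, integral_pow_mul_coneProfile hn _ hs, mul_left_comm,
      succ_mul_beta_eq, div_eq_mul_inv]

/-- Berwald's inequality in terms of radial moments: s is the extent of the cone whose moment of
order n equals that of the ray profile. -/
theorem radialMoment_covariogram_le (hn : n ≠ 0) (hK : IsConvexBody K)
    (h1 : volume K = 1) {x : EuclideanSpace ℝ (Fin n)} (hx : x ≠ 0) :
    ∃ s > 0, radialMoment n (covariogram K) x = ENNReal.ofReal (s ^ n / (2 * n).choose n) ∧
      radialMoment ((n : ℝ) + 2) (covariogram K) x ≤
        ENNReal.ofReal (s ^ (n + 2) / (2 * n + 2).choose n) ∧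
      (ENNReal.ofReal (s ^ (n + 2) / (2 * n + 2).choose n) ≤
        radialMoment ((n : ℝ) + 2) (covariogram K) x →
        ∀ t, 0 < t → covariogram K (t • x) = coneProfile n s t) := by
  have hf := isRootConcaveProfile_covariogram hn hK h1 hx
  have hn' : ((n - 1 : ℕ) : ℝ) + 1 = n := by
    rw [← Nat.cast_add_one]; congr 1; omega
  set β : ℝ := (n - 1).factorial * n.factorial / (n - 1 + n + 1).factorial with hβ
  have hβ0 : 0 < β := by positivity
  have hI := hf.integral_pos hn (n - 1)
  set I := ∫ t in Set.Ioi 0, t ^ (n - 1) * covariogram K (t • x)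
  set s := (I / β) ^ (n : ℝ)⁻¹ with hs
  have hs0 : 0 < s := by positivity
  have hsn : s ^ n = I / β := Real.rpow_inv_natCast_pow (by positivity) hn
  have hm : I = ∫ t in Set.Ioi 0, t ^ (n - 1) * coneProfile n s t := by
    rw [integral_pow_mul_coneProfile hn _ hs0, Nat.sub_add_cancel (Nat.one_le_iff_ne_zero.2 hn),
      hsn, ← hβ, div_mul_cancel₀ _ hβ0.ne']
  obtain ⟨hle, heq⟩ := hf.integral_le_coneProfile hn hs0 hm
  have e2 : s ^ (n + 2) / ((2 * n + 2).choose n : ℝ) = ((n + 1 : ℕ) + 1 : ℝ) *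
      ∫ t in Set.Ioi 0, t ^ (n + 1) * coneProfile n s t := by
    rw [integral_pow_mul_coneProfile hn _ hs0, mul_left_comm, succ_mul_beta_eq, div_eq_mul_inv]
  refine ⟨s, hs0, ?_, ?_, fun h => heq (le_antisymm hle ?_)⟩
  · rw [radialMoment_natCast (k := n - 1) hn'.symm (covariogram_nonneg K) (hf.integrableOn _), hn',
      hsn, div_eq_mul_inv (I / β), ← pred_mul_beta_eq hn, ← hβ]
    congr 1
    field_simp
    rfl
  · rw [radialMoment_natCast (k := n + 1) (by push_cast; ring) (covariogram_nonneg K)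
      (hf.integrableOn _), e2]
    exact ENNReal.ofReal_le_ofReal (mul_le_mul_of_nonneg_left hle (by positivity))
  · rw [radialMoment_natCast (k := n + 1) (by push_cast; ring) (covariogram_nonneg K)
      (hf.integrableOn _), e2, ENNReal.ofReal_le_ofReal_iff
      (mul_nonneg (by positivity) (hf.integral_pos hn (n + 1)).le)] at h
    exact le_of_mul_le_mul_left h (by positivity)

theorem volume_ballBody_covariogram (hn : n ≠ 0) (hK : IsConvexBody K) (h1 : volume K = 1) :
    volume (ballBody (n : ℝ) (covariogram K)) = 1 := by
  have h := (isLogConcaveDensity_covariogram hK h1).lintegral_ballBody hn (d := 0) (p := n)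
    (by simp) (q := fun _ => 1) measurable_const (by simp)
  rw [lintegral_covariogram hK.1 measurable_const] at h
  simpa [h1] using h

/-- Let s(x) be the extent of the comparison cone on the ray of x. The cone of extent σ has moment
of order n + 2 equal to 1, so x ∈ T implies s(x) ≥ σ by Berwald; and r is chosen so that r x ∈ S if
and only if s(x) ≥ σ. Hence r T ⊆ S, with |S| = 1 and |r T| = κ|T|. -/
theorem volume_ballBody_covariogram_le (hn : n ≠ 0) (hK : IsConvexBody K) (h1 : volume K = 1)
    {σ : ℝ} (hσ : 0 < σ) (hσ' : σ ^ (n + 2) = (2 * n + 2).choose n) :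
    σ ^ n / (2 * n).choose n * volume.real (ballBody ((n : ℝ) + 2) (covariogram K)) ≤ 1 ∧
    (σ ^ n / (2 * n).choose n * volume.real (ballBody ((n : ℝ) + 2) (covariogram K)) = 1 ↔
      ∀ x ≠ 0, ∃ s > 0, ∀ t, 0 < t → covariogram K (t • x) = coneProfile n s t) := by
  have hg := isLogConcaveDensity_covariogram hK h1
  have hC : (0 : ℝ) < (2 * n).choose n := by
    exact_mod_cast Nat.choose_pos (by omega)
  have hC2 : (0 : ℝ) < (2 * n + 2).choose n := by
    exact_mod_cast Nat.choose_pos (by omega)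
  have hn0 : (0 : ℝ) < n := by exact_mod_cast Nat.pos_of_ne_zero hn
  set κ := σ ^ n / (2 * n).choose n with hκ
  have hκ0 : 0 < κ := by positivity
  set r := κ ^ (n : ℝ)⁻¹ with hr
  have hr0 : 0 < r := by positivity
  have hrn : r ^ n = κ := Real.rpow_inv_natCast_pow hκ0.le hn
  set T := ballBody ((n : ℝ) + 2) (covariogram K) with hT
  set S := ballBody (n : ℝ) (covariogram K) with hS
  have hTb : IsConvexBody T := hg.isConvexBody_ballBody (by positivity)
  have hSb : IsConvexBody S := hg.isConvexBody_ballBody hn0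
  have hS1 : volume S = 1 := volume_ballBody_covariogram hn hK h1
  have scaleN (x : EuclideanSpace ℝ (Fin n)) {c : ℝ} (hc : 0 < c) :
      radialMoment n (covariogram K) (c • x) =
        ENNReal.ofReal (c ^ n)⁻¹ * radialMoment n (covariogram K) x := by
    rw [radialMoment_smul _ hc, Real.rpow_neg hc.le, Real.rpow_natCast]
  have scaleN2 (x : EuclideanSpace ℝ (Fin n)) {c : ℝ} (hc : 0 < c) :
      radialMoment ((n : ℝ) + 2) (covariogram K) (c • x) =
        ENNReal.ofReal (c ^ (n + 2))⁻¹ * radialMoment ((n : ℝ) + 2) (covariogram K) x := by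
    rw [radialMoment_smul _ hc, Real.rpow_neg hc.le, ← Real.rpow_natCast]
    push_cast
    rfl
  have memS {x : EuclideanSpace ℝ (Fin n)} {s : ℝ} (hs : 0 < s)
      (h : radialMoment n (covariogram K) x = ENNReal.ofReal (s ^ n / (2 * n).choose n)) :
      r • x ∈ S ↔ σ ≤ s := by
    rw [hS, hg.mem_ballBody, scaleN x hr0, h, ← ENNReal.ofReal_mul (by positivity),
      ENNReal.one_le_ofReal, hrn, ← div_eq_inv_mul, one_le_div hκ0, hκ,
      div_le_div_iff_of_pos_right hC, pow_le_pow_iff_left₀ hσ.le hs.le hn]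
  have zero_mem {p : ℝ} (hp : 0 < p) : (0 : EuclideanSpace ℝ (Fin n)) ∈ ballBody p (covariogram K) :=
    mem_of_mem_nhds (hg.ballBody_mem_nhds_zero hp)
  have hsub : r • T ⊆ S := by
    rintro _ ⟨x, hx, rfl⟩
    by_cases hx0 : x = 0
    · simp only [hx0, smul_zero]; exact zero_mem hn0
    obtain ⟨s, hs, hm, hle, -⟩ := radialMoment_covariogram_le hn hK h1 hx0
    refine (memS hs hm).2 ?_
    have := (hg.mem_ballBody.1 hx).trans hle
    rw [ENNReal.one_le_ofReal, one_le_div hC2, ← hσ'] at this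
    exact (pow_le_pow_iff_left₀ hσ.le hs.le (by omega)).1 this
  have hvol : κ * volume.real T = volume.real (r • T) := by rw [volume_real_smul hr0.le, hrn]
  have hS1' : volume.real S = 1 := by simp [Measure.real, hS1]
  rw [hvol]
  refine ⟨hS1' ▸ measureReal_mono hsub hSb.1.measure_lt_top.ne, fun h x hx => ?_, fun h => ?_⟩
  · have heq : r • T = S := by
      refine eq_of_subset_of_volume_eq (hTb.1.smul r).isClosed hSb hsub ?_
      rw [hS1, ← ENNReal.ofReal_one, ← h, ofReal_measureReal (hTb.1.smul r).measure_lt_top.ne]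
    obtain ⟨s, hs, hm, hle, hcone⟩ := radialMoment_covariogram_le hn hK h1 hx
    refine ⟨s, hs, hcone ?_⟩
    -- The multiple (s/σ)x has comparison cone of extent exactly σ, so r(s/σ)x ∈ S = r T. Membership
    -- of (s/σ)x in T is then the equality case of Berwald's inequality.
    have hc : 0 < s / σ := by positivity
    have hmem : r • (s / σ) • x ∈ S := by
      refine (memS hσ ?_).2 le_rfl
      rw [scaleN x hc, hm, ← ENNReal.ofReal_mul (by positivity)]
      congr 1
      field_simp
      rw [div_pow, div_mul_cancel₀ _ (by positivity)]
    rw [← heq, Set.smul_mem_smul_set_iff₀ hr0.ne', hT, hg.mem_ballBody, scaleN2 x hc] at hmem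
    calc ENNReal.ofReal (s ^ (n + 2) / (2 * n + 2).choose n)
        = ENNReal.ofReal ((s / σ) ^ (n + 2)) * 1 := by rw [← hσ', div_pow, mul_one]
      _ ≤ ENNReal.ofReal ((s / σ) ^ (n + 2)) * (ENNReal.ofReal ((s / σ) ^ (n + 2))⁻¹ *
            radialMoment ((n : ℝ) + 2) (covariogram K) x) := by gcongr
      _ = _ := by
        rw [← mul_assoc, ← ENNReal.ofReal_mul (by positivity), mul_inv_cancel₀ (by positivity),
          ENNReal.ofReal_one, one_mul]
  · have heq : r • T = S := by
      refine hsub.antisymm fun y hy => ?_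
      rw [Set.mem_smul_set_iff_inv_smul_mem₀ hr0.ne']
      by_cases hy0 : y = 0
      · rw [hy0, smul_zero]; exact zero_mem (by positivity)
      have hx0 : r⁻¹ • y ≠ 0 := smul_ne_zero (inv_ne_zero hr0.ne') hy0
      obtain ⟨s, hs, hcone⟩ := h _ hx0
      obtain ⟨hm, hm2⟩ := radialMoment_covariogram_of_eq_coneProfile hn hK h1 hx0 hs hcone
      have hσs : σ ≤ s := (memS hs hm).1 (by rwa [smul_smul, mul_inv_cancel₀ hr0.ne', one_smul])
      rw [hT, hg.mem_ballBody, hm2, ENNReal.one_le_ofReal, one_le_div hC2, ← hσ']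
      gcongr
    rw [heq, hS1']

end

/-! ### Uniqueness of the isotropic constant -/

section Isotropic

variable {n : ℕ} {K : Set (EuclideanSpace ℝ (Fin n))} {L L' : ℝ}

theorem AffineEquiv.eq_linear_add {E : Type*} [AddCommGroup E] [Module ℝ E] (A : E ≃ᵃ[ℝ] E)
    (x : E) : A x = A.linear x + A 0 := by
  simpa using A.map_vadd 0 x

theorem AffineEquiv.measurePreserving_of_volume_image
    (A : EuclideanSpace ℝ (Fin n) ≃ᵃ[ℝ] EuclideanSpace ℝ (Fin n)) (hK : volume K = 1)
    (hA : volume (A '' K) = 1) : MeasurePreserving A ∧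
      |LinearMap.det (A.linear : EuclideanSpace ℝ (Fin n) →ₗ[ℝ] EuclideanSpace ℝ (Fin n))| = 1 := by
  have e : (A : EuclideanSpace ℝ (Fin n) → EuclideanSpace ℝ (Fin n)) =
      (fun x => x + A 0) ∘ A.linear := funext A.eq_linear_add
  have hdet : |LinearMap.det (A.linear : EuclideanSpace ℝ (Fin n) →ₗ[ℝ] _)| = 1 := by
    rw [e, Set.image_comp, Set.image_add_right, measure_preimage_add_right] at hA
    have := Measure.addHaar_image_linearMap volume
      (A.linear : EuclideanSpace ℝ (Fin n) →ₗ[ℝ] EuclideanSpace ℝ (Fin n)) K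
    rw [LinearEquiv.coe_coe, hA, hK, mul_one, eq_comm, ENNReal.ofReal_eq_one] at this
    exact this
  refine ⟨?_, hdet⟩
  rw [e]
  refine (measurePreserving_add_right volume (A 0)).comp ⟨?_, ?_⟩
  · exact (LinearMap.continuous_of_finiteDimensional
      (A.linear : EuclideanSpace ℝ (Fin n) →ₗ[ℝ] EuclideanSpace ℝ (Fin n))).measurable
  · have h0 : LinearMap.det (A.linear : EuclideanSpace ℝ (Fin n) →ₗ[ℝ] _) ≠ 0 := by
      intro h0; rw [h0] at hdet; simp at hdet
    have := Measure.map_linearMap_addHaar_eq_smul_addHaar volume h0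
    rwa [abs_inv, hdet, inv_one, ENNReal.ofReal_one, one_smul] at this

theorem IsIsotropicWith.integrableOn (hK : IsIsotropicWith K L) {F : Type*} [NormedAddCommGroup F]
    {f : EuclideanSpace ℝ (Fin n) → F} (hf : Continuous f) : IntegrableOn f K :=
  hf.continuousOn.integrableOn_compact hK.convexBody.1

theorem IsIsotropicWith.integral_inner (hK : IsIsotropicWith K L)
    (θ : EuclideanSpace ℝ (Fin n)) : ∫ x in K, inner ℝ x θ = 0 := by
  simp_rw [real_inner_comm θ]
  have := _root_.integral_inner (𝕜 := ℝ) (hK.integrableOn continuous_id) θ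
  simpa [hK.barycenter_eq_zero] using this

theorem IsIsotropicWith.integral_inner_sq' (hK : IsIsotropicWith K L)
    (θ : EuclideanSpace ℝ (Fin n)) : ∫ x in K, (inner ℝ x θ) ^ 2 = L ^ 2 * ‖θ‖ ^ 2 := by
  by_cases hθ : θ = 0
  · simp [hθ]
  have hθ' : ‖θ‖ ≠ 0 := norm_ne_zero_iff.2 hθ
  rw [← hK.integral_inner_sq (‖θ‖⁻¹ • θ) (by
    rw [norm_smul, norm_inv, norm_norm, inv_mul_cancel₀ hθ']), ← integral_mul_const]
  congr with x
  rw [inner_smul_right]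
  field_simp

/-- Barycenters show that A is linear, A = T. Comparing ∫_K ⟨Tx,θ⟩² = ∫_K ⟨x,T*θ⟩² with the two
isotropy conditions gives ‖T*θ‖ = (L'/L)‖θ‖, so T* and then T are multiples of isometries;
preservation of volume forces the factor to be 1. -/
theorem IsIsotropicWith.eq_and_norm_map (hn : n ≠ 0) (hK : IsIsotropicWith K L)
    (A : EuclideanSpace ℝ (Fin n) ≃ᵃ[ℝ] EuclideanSpace ℝ (Fin n))
    (hA : IsIsotropicWith (A '' K) L') : L = L' ∧ ∀ x, ‖A.linear x‖ = ‖x‖ := by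
  obtain ⟨hmp, hdet⟩ := A.measurePreserving_of_volume_image hK.volume_eq_one hA.volume_eq_one
  set T : EuclideanSpace ℝ (Fin n) →ₗ[ℝ] EuclideanSpace ℝ (Fin n) := A.linear.toLinearMap with hT
  have hemb : MeasurableEmbedding A :=
    (AffineEquiv.toContinuousAffineEquiv A).toHomeomorph.measurableEmbedding
  have hL := hK.pos
  have hL' := hA.pos
  have hTc : Continuous T := T.continuous_of_finiteDimensional
  obtain ⟨b, hlin⟩ : ∃ b, ∀ x, A x = T x + b := ⟨A 0, A.eq_linear_add⟩
  have hb : b = 0 := by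
    have h := hA.barycenter_eq_zero
    rw [hmp.setIntegral_image_emb hemb] at h
    simp_rw [hlin] at h
    rw [integral_add (hK.integrableOn hTc) (hK.integrableOn continuous_const)] at h
    have h2 : ∫ x in K, T x = 0 := by
      have := ContinuousLinearMap.integral_comp_comm (LinearMap.toContinuousLinearMap T)
        (hK.integrableOn continuous_id)
      exact this.trans ((congrArg _ hK.barycenter_eq_zero).trans (map_zero _))
    rw [h2, zero_add, setIntegral_const, Measure.real, hK.volume_eq_one] at h
    simpa using h
  have hAT : ∀ x, A x = T x := fun x => by rw [hlin, hb, add_zero]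
  set c := L' / L with hc
  have hc0 : 0 < c := by positivity
  have hadj : ∀ θ, ‖LinearMap.adjoint T θ‖ = c * ‖θ‖ := by
    intro θ
    have h := hA.integral_inner_sq' θ
    rw [hmp.setIntegral_image_emb hemb] at h
    simp_rw [hAT, ← LinearMap.adjoint_inner_right] at h
    rw [hK.integral_inner_sq'] at h
    rw [← pow_left_inj₀ (norm_nonneg _) (by positivity) two_ne_zero, mul_pow, hc, div_pow]
    field_simp
    linear_combination h
  have hle : ∀ x, ‖T x‖ ≤ c * ‖x‖ := by
    intro x
    by_cases h0 : T x = 0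
    · rw [h0, norm_zero]; positivity
    have h := real_inner_self_eq_norm_sq (T x)
    rw [← LinearMap.adjoint_inner_right] at h
    have h2 := real_inner_le_norm x (LinearMap.adjoint T (T x))
    rw [h, hadj] at h2
    have := norm_pos_iff.2 h0
    nlinarith
  have hsurj : Function.Surjective (LinearMap.adjoint T) := by
    rw [← LinearMap.injective_iff_surjective, injective_iff_map_eq_zero]
    intro θ hθ
    have := hadj θ
    rw [hθ, norm_zero] at this
    exact norm_eq_zero.1 ((mul_eq_zero.1 this.symm).resolve_left hc0.ne')
  have hge : ∀ x, c * ‖x‖ ≤ ‖T x‖ := by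
    intro x
    by_cases h0 : x = 0
    · rw [h0, norm_zero, mul_zero]; positivity
    obtain ⟨θ, rfl⟩ := hsurj x
    set x := LinearMap.adjoint T θ
    have h := real_inner_self_eq_norm_sq x
    have h' : inner ℝ x x = inner ℝ (T x) θ := LinearMap.adjoint_inner_right T x θ
    have h2 := real_inner_le_norm (T x) θ
    rw [← h', h] at h2
    have h3 : ‖x‖ = c * ‖θ‖ := hadj θ
    have h4 := norm_pos_iff.2 h0
    have : ‖x‖ * (c * ‖x‖) ≤ ‖x‖ * ‖T x‖ := by
      calc ‖x‖ * (c * ‖x‖) = c * ‖x‖ ^ 2 := by ring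
        _ ≤ c * (‖T x‖ * ‖θ‖) := by gcongr
        _ = ‖x‖ * ‖T x‖ := by rw [h3]; ring
    exact le_of_mul_le_mul_left this h4
  have hnorm : ∀ x, ‖T x‖ = c * ‖x‖ := fun x => le_antisymm (hle x) (hge x)
  -- T maps the unit ball onto the ball of radius c; as |det T| = 1, this gives cⁿ = 1.
  have himg : T '' Metric.closedBall 0 1 = Metric.closedBall 0 c := by
    ext y
    simp only [Set.mem_image, mem_closedBall_zero_iff]
    constructor
    · rintro ⟨x, hx, rfl⟩
      rw [hnorm]; exact mul_le_of_le_one_right hc0.le hx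
    · intro hy
      obtain ⟨x, rfl⟩ := A.linear.surjective y
      refine ⟨x, ?_, rfl⟩
      have : ‖A.linear x‖ = c * ‖x‖ := hnorm x
      rw [this] at hy
      exact le_of_mul_le_mul_left (by linarith) hc0
  have hc1 : c = 1 := by
    have h := Measure.addHaar_image_linearMap volume T (Metric.closedBall 0 1)
    rw [himg, hdet, ENNReal.ofReal_one, one_mul, Measure.addHaar_closedBall _ _ hc0.le,
      Measure.addHaar_closedBall _ _ zero_le_one, one_pow, ENNReal.ofReal_one,
      finrank_euclideanSpace_fin] at h
    have hpos : volume (Metric.ball (0 : EuclideanSpace ℝ (Fin n)) 1) ≠ 0 :=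
      (Metric.measure_ball_pos _ _ one_pos).ne'
    rw [ENNReal.mul_left_inj hpos measure_ball_lt_top.ne, ENNReal.ofReal_eq_one] at h
    exact (pow_eq_one_iff_of_nonneg hc0.le hn).1 h
  refine ⟨?_, fun x => ?_⟩
  · rw [hc, div_eq_one_iff_eq hL.ne'] at hc1; exact hc1.symm
  · have : ‖A.linear x‖ = c * ‖x‖ := hnorm x
    rw [this, hc1, one_mul]

theorem HasIsotropicConstant.isotropicConstant_eq (hn : n ≠ 0) (h : HasIsotropicConstant K L) :
    isotropicConstant K = L := by
  have hex : ∃ L, HasIsotropicConstant K L := ⟨L, h⟩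
  rw [isotropicConstant, dif_pos hex]
  obtain ⟨A, hA⟩ := hex.choose_spec
  obtain ⟨B, hB⟩ := h
  refine (hA.eq_and_norm_map hn (A.symm.trans B) ?_).1
  convert hB using 1
  rw [← Set.image_comp]
  congr 1
  ext x : 1
  simp

theorem IsIsotropicWith.isotropicConstant_eq (hn : n ≠ 0) (h : IsIsotropicWith K L) :
    isotropicConstant K = L :=
  HasIsotropicConstant.isotropicConstant_eq hn ⟨AffineEquiv.refl ℝ _, by simpa using h⟩

/-- The isotropic constant of a centered body whose inertia tensor is a multiple of the identity. -/
theorem isotropicConstant_of_integral_inner_sq (hn : n ≠ 0) (hK : IsConvexBody K)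
    (hb : ∫ x in K, x = 0) {m : ℝ} (hm : 0 < m)
    (h : ∀ θ : EuclideanSpace ℝ (Fin n), ‖θ‖ = 1 → ∫ x in K, (inner ℝ x θ) ^ 2 = m) :
    isotropicConstant K = √m * volume.real K ^ (-((1 : ℝ) / 2 + 1 / n)) := by
  have hV : 0 < volume.real K := ENNReal.toReal_pos
    ((isOpen_interior.measure_pos volume hK.2.2).trans_le (measure_mono interior_subset)).ne'
    hK.1.measure_lt_top.ne
  set V := volume.real K with hVd
  have hn0 : (0 : ℝ) < n := by exact_mod_cast Nat.pos_of_ne_zero hn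
  set r := V⁻¹ ^ (n : ℝ)⁻¹ with hr
  have hr0 : 0 < r := by positivity
  have hrn : r ^ n = V⁻¹ := Real.rpow_inv_natCast_pow (by positivity) hn
  have himg : ((LinearEquiv.smulOfNeZero ℝ (EuclideanSpace ℝ (Fin n)) r hr0.ne').toAffineEquiv) '' K
      = r • K := by
    rfl
  have key {F : Type} [NormedAddCommGroup F] [NormedSpace ℝ F] (f : EuclideanSpace ℝ (Fin n) → F) :
      ∫ x in r • K, f x = V⁻¹ • ∫ x in K, f (r • x) := by
    rw [Measure.setIntegral_comp_smul_of_pos volume f K hr0, smul_smul, finrank_euclideanSpace_fin,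
      hrn, mul_inv_cancel₀ (by positivity), one_smul]
  refine HasIsotropicConstant.isotropicConstant_eq hn
    ⟨(LinearEquiv.smulOfNeZero ℝ (EuclideanSpace ℝ (Fin n)) r hr0.ne').toAffineEquiv, ?_⟩
  rw [himg]
  refine ⟨⟨hK.1.smul r, hK.2.1.smul r, ?_⟩, ?_, ?_, by positivity, ?_⟩
  · rw [interior_smul₀ hr0.ne']; exact hK.2.2.smul_set
  · rw [← ENNReal.toReal_eq_one_iff]
    change volume.real (r • K) = 1
    rw [volume_real_smul hr0.le, hrn, inv_mul_cancel₀ hV.ne']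
  · rw [key, integral_smul, hb, smul_zero, smul_zero]
  · intro θ hθ
    rw [key]
    simp_rw [real_inner_smul_left, mul_pow]
    rw [integral_const_mul, h θ hθ, Real.sq_sqrt hm.le, smul_eq_mul, ← Real.rpow_natCast r,
      hr, ← Real.rpow_mul (by positivity), Real.inv_rpow hV.le, ← Real.rpow_neg hV.le,
      ← Real.rpow_neg_one V, ← mul_assoc, ← Real.rpow_add hV, mul_comm, ← Real.rpow_natCast (V ^ _),
      ← Real.rpow_mul hV.le]
    congr 2
    push_cast
    ring

end Isotropic

/-! ### Inertia and isotropic constant of Ball's body of order n + 2. -/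

section SecondMoment

variable {n : ℕ} {K : Set (EuclideanSpace ℝ (Fin n))} {L : ℝ}

/-- The cross term vanishes because the barycenter is 0. -/
theorem IsIsotropicWith.lintegral_inner_sub_sq (hK : IsIsotropicWith K L)
    {θ : EuclideanSpace ℝ (Fin n)} (hθ : ‖θ‖ = 1) :
    ∫⁻ y in K, ∫⁻ z in K, ENNReal.ofReal ((inner ℝ (y - z) θ) ^ 2) = ENNReal.ofReal (2 * L ^ 2) := by
  have hV : volume.real K = 1 := by simp [Measure.real, hK.volume_eq_one]
  have h1 : ∀ y, ∫⁻ z in K, ENNReal.ofReal ((inner ℝ (y - z) θ) ^ 2) =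
      ENNReal.ofReal ((inner ℝ y θ) ^ 2 + L ^ 2) := by
    intro y
    rw [← ofReal_integral_eq_lintegral_ofReal (hK.integrableOn (by fun_prop))
      (.of_forall fun z => sq_nonneg _)]
    have e : ∀ z, (inner ℝ (y - z) θ) ^ 2 = ((inner ℝ y θ) ^ 2 - 2 * inner ℝ y θ * inner ℝ z θ) +
        (inner ℝ z θ) ^ 2 := by
      intro z; rw [inner_sub_left]; ring
    simp_rw [e]
    rw [integral_add (hK.integrableOn (by fun_prop)) (hK.integrableOn (by fun_prop)),
      integral_sub (hK.integrableOn (by fun_prop)) (hK.integrableOn (by fun_prop)),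
      integral_const_mul, hK.integral_inner, hK.integral_inner_sq θ hθ, setIntegral_const, hV]
    simp
  simp_rw [h1]
  rw [← ofReal_integral_eq_lintegral_ofReal (hK.integrableOn (by fun_prop))
    (.of_forall fun z => by positivity), integral_add (hK.integrableOn (by fun_prop))
    (hK.integrableOn (by fun_prop)), hK.integral_inner_sq θ hθ, setIntegral_const, hV]
  congr 1
  simp
  ring

/-- The body is symmetric because g_K is even, and its inertia in direction θ is ∫ ⟨x,θ⟩² g_K = 2L²,
so only a dilation to volume 1 is missing. -/
theorem IsIsotropicWith.isotropicConstant_ballBody (hn : n ≠ 0) (hK : IsIsotropicWith K L) :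
    isotropicConstant (ballBody ((n : ℝ) + 2) (covariogram K)) =
      √2 * L * volume.real (ballBody ((n : ℝ) + 2) (covariogram K)) ^ (-((1 : ℝ) / 2 + 1 / n)) := by
  have hg := isLogConcaveDensity_covariogram hK.convexBody hK.volume_eq_one
  have hT := hg.isConvexBody_ballBody (p := (n : ℝ) + 2) (by positivity)
  have hL := hK.pos
  rw [isotropicConstant_of_integral_inner_sq hn hT (m := 2 * L ^ 2) ?_ (by positivity) ?_,
    Real.sqrt_mul zero_le_two, Real.sqrt_sq hL.le]
  · have hmem : ∀ x, -x ∈ ballBody ((n : ℝ) + 2) (covariogram K) ↔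
        x ∈ ballBody ((n : ℝ) + 2) (covariogram K) := by
      intro x
      rw [hg.mem_ballBody, hg.mem_ballBody, radialMoment, radialMoment]
      simp_rw [smul_neg, covariogram_neg]
    rw [← integral_indicator hT.1.measurableSet]
    set F := (ballBody ((n : ℝ) + 2) (covariogram K)).indicator fun x => x with hF
    have hodd : ∀ x, F (-x) = -F x := by
      intro x
      by_cases hx : x ∈ ballBody ((n : ℝ) + 2) (covariogram K)
      · rw [hF, Set.indicator_of_mem hx, Set.indicator_of_mem ((hmem x).2 hx)]
      · rw [hF, Set.indicator_of_notMem hx, Set.indicator_of_notMem (mt (hmem x).1 hx), neg_zero]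
    have h := integral_neg_eq_self F volume
    simp_rw [hodd] at h
    rw [integral_neg] at h
    have h2 : (2 : ℝ) • ∫ x, F x = 0 := by
      rw [two_smul]
      nth_rewrite 1 [← h]
      exact neg_add_cancel _
    exact (smul_eq_zero.1 h2).resolve_left two_ne_zero
  · intro θ hθ
    have h := hg.lintegral_ballBody hn (d := 2) (p := (n : ℝ) + 2) (by push_cast; rfl)
      (q := fun x => ENNReal.ofReal ((inner ℝ x θ) ^ 2)) (by fun_prop) (by
        intro t ht x
        rw [real_inner_smul_left, mul_pow, ENNReal.ofReal_mul (by positivity)])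
    rw [lintegral_covariogram hK.convexBody.1 (q := fun x => ENNReal.ofReal ((inner ℝ x θ) ^ 2))
      (by fun_prop), hK.lintegral_inner_sub_sq hθ] at h
    rw [integral_eq_lintegral_of_nonneg_ae (.of_forall fun x => sq_nonneg _)
      (by fun_prop), h, ENNReal.toReal_ofReal (by positivity)]

end SecondMoment

/-! ### Characterizations of simplices -/

section Cone

variable {E : Type*} [AddCommGroup E] [Module ℝ E] {K : Set E}

/-- The cone over `K × {1}`. -/
def coneOver (K : Set E) : Set (E × ℝ) := {v | 0 ≤ v.2 ∧ v.1 ∈ v.2 • K}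

theorem smul_mem_coneOver {y : E} (hy : y ∈ K) {h : ℝ} (hh : 0 ≤ h) :
    h • ((y, 1) : E × ℝ) ∈ coneOver K :=
  ⟨by simpa using hh, by simpa using Set.smul_mem_smul_set hy⟩

theorem Convex.add_mem_coneOver (hK : Convex ℝ K) {u v : E × ℝ} (hu : u ∈ coneOver K)
    (hv : v ∈ coneOver K) : u + v ∈ coneOver K := by
  refine ⟨add_nonneg hu.1 hv.1, ?_⟩
  rw [Prod.snd_add, hK.add_smul hu.1 hv.1]
  exact Set.add_mem_add hu.2 hv.2

/-- In the order given by the cone over `K`, the generators of `e` and `f` are disjoint. -/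
def IsConeDisjoint (K : Set E) (e f : E) : Prop :=
  ∀ t : ℝ, 0 < t → t < 1 → ∀ y ∈ K, y - t • (e - f) ∈ K → ∃ q ∈ K, y = (1 - t) • q + t • e

/-- Homogeneous form of disjointness: for u of height above t, if u + t(f,1) dominates t(e,1) in the
cone order, then u alone does. -/
theorem IsConeDisjoint.sub_mem_coneOver {e f : E} (hef : IsConeDisjoint K e f) {u : E × ℝ}
    (hu : u ∈ coneOver K) {t : ℝ} (ht : 0 < t) (htu : t < u.2)
    (h : u + t • (f, 1) - t • (e, 1) ∈ coneOver K) : u - t • (e, 1) ∈ coneOver K := by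
  obtain ⟨y, H⟩ := u
  obtain ⟨hH, k, hk, hky⟩ := hu
  simp only at hH hky htu
  have hH0 : 0 < H := ht.trans htu
  obtain ⟨-, k', hk', hky'⟩ := h
  simp only [Prod.fst_sub, Prod.fst_add, Prod.snd_sub, Prod.snd_add, Prod.smul_fst,
    Prod.smul_snd, smul_eq_mul, mul_one, add_sub_cancel_right] at hky'
  obtain ⟨q, hq, hkq⟩ := hef (t / H) (by positivity) ((div_lt_one hH0).2 htu) k hk (by
    have : k - (t / H) • (e - f) = k' := by
      apply smul_right_injective E hH0.ne'
      simp only [smul_sub, smul_smul, mul_div_cancel₀ _ hH0.ne', hky, hky']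
      abel
    rwa [this])
  refine ⟨by simpa using htu.le, q, hq, ?_⟩
  simp only [Prod.fst_sub, Prod.snd_sub, Prod.smul_fst, Prod.smul_snd, smul_eq_mul, mul_one]
  rw [← hky, hkq, smul_add, smul_smul, smul_smul, mul_div_cancel₀ _ hH0.ne', mul_sub, mul_one,
    mul_div_cancel₀ _ hH0.ne', add_sub_cancel_right]

/-- Any multiple of (f,1) can be removed, by enlarging it to a multiple N t and removing t(f,1) at
each step. -/
theorem IsConeDisjoint.sub_mem_coneOver_of_add (hK : Convex ℝ K) {e f : E}
    (hef : IsConeDisjoint K e f) (hf : f ∈ K) {u : E × ℝ}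
    (hu : u ∈ coneOver K) {t : ℝ} (ht : 0 < t) (htu : t < u.2) {b : ℝ}
    (h : u + b • (f, 1) - t • (e, 1) ∈ coneOver K) : u - t • (e, 1) ∈ coneOver K := by
  have step : ∀ N : ℕ, u + (N * t) • ((f, 1) : E × ℝ) - t • (e, 1) ∈ coneOver K →
      u - t • (e, 1) ∈ coneOver K := by
    intro N
    induction N with
    | zero => intro h; simpa using h
    | succ N ih =>
      intro h
      apply ih
      have hN : 0 ≤ N * t := by positivity
      refine hef.sub_mem_coneOver (hK.add_mem_coneOver hu (smul_mem_coneOver hf hN)) ht ?_ ?_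
      · simp only [Prod.snd_add, Prod.smul_snd, smul_eq_mul, mul_one]; linarith
      · rw [add_assoc, ← add_smul]
        convert h using 4
        push_cast; ring
  obtain ⟨N, hN⟩ := exists_nat_ge (b / t)
  rw [div_le_iff₀ ht] at hN
  apply step N
  have := hK.add_mem_coneOver h (smul_mem_coneOver hf (sub_nonneg.2 hN))
  convert this using 1
  rw [sub_smul]
  abel

/-- Were e ≠ f, the extreme point f would be a proper convex combination of e and another point of
K. -/
theorem eq_of_sub_mem_coneOver {e f : E} (he : e ∈ K) (hf : f ∈ Set.extremePoints ℝ K) {a b : ℝ}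
    (ha : 0 < a) (h : b • ((f, 1) : E × ℝ) - a • (e, 1) ∈ coneOver K) : e = f := by
  obtain ⟨h0, q, hq, hqe⟩ := h
  simp only [Prod.fst_sub, Prod.snd_sub, Prod.smul_fst, Prod.smul_snd, smul_eq_mul, mul_one]
    at h0 hqe
  have hb : 0 < b := by linarith
  rcases h0.eq_or_lt with h1 | h1
  · rw [← h1, zero_smul, eq_comm, sub_eq_zero, show b = a by linarith] at hqe
    exact (smul_right_injective E ha.ne' hqe).symm
  · refine ((mem_extremePoints.1 hf).2 e he q hq ⟨a / b, (b - a) / b, by positivity, by positivity,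
      by field_simp; ring, ?_⟩).1
    apply smul_right_injective E hb.ne'
    simp only [smul_add, smul_smul, mul_div_cancel₀ _ hb.ne', hqe]
    abel

theorem Convex.sum_mem_coneOver (hK : Convex ℝ K) {e : E} (he : e ∈ K) {ι : Type*} (s : Finset ι)
    (p : ι → E) (b : ι → ℝ) (hb : ∀ i ∈ s, 0 ≤ b i) (hp : ∀ i ∈ s, p i ∈ K) :
    ∑ i ∈ s, b i • ((p i, 1) : E × ℝ) ∈ coneOver K := by
  classical
  induction s using Finset.induction_on with
  | empty => simpa using smul_mem_coneOver he le_rfl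
  | insert j s hj ih =>
    simp only [Finset.mem_insert, forall_eq_or_imp] at hb hp
    rw [Finset.sum_insert hj]
    exact hK.add_mem_coneOver (smul_mem_coneOver hp.1 hb.1) (ih hb.2 hp.2)

/-- Disjointness removes the summands one at a time, until a single extreme generator would have to
dominate a multiple of (e,1). -/
theorem sum_sub_notMem_coneOver (hK : Convex ℝ K) {e : E} (he : e ∈ K) {ι : Type*} (s : Finset ι)
    (p : ι → E) (b : ι → ℝ) (hb : ∀ i ∈ s, 0 ≤ b i) (hp : ∀ i ∈ s, p i ∈ Set.extremePoints ℝ K)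
    (hd : ∀ i ∈ s, IsConeDisjoint K e (p i)) (hne : ∀ i ∈ s, e ≠ p i) :
    ∀ a : ℝ, 0 < a → ∑ i ∈ s, b i • ((p i, 1) : E × ℝ) - a • (e, 1) ∉ coneOver K := by
  classical
  induction s using Finset.induction_on with
  | empty =>
    intro a ha h
    have := h.1
    simp only [Finset.sum_empty, zero_sub, Prod.snd_neg, Prod.smul_snd, smul_eq_mul, mul_one] at this
    linarith
  | insert j s hj ih =>
    intro a ha h
    simp only [Finset.mem_insert, forall_eq_or_imp] at hb hp hd hne
    have ih' := ih hb.2 hp.2 hd.2 hne.2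
    rw [Finset.sum_insert hj] at h
    have hsnd : (∑ i ∈ s, b i • ((p i, 1) : E × ℝ)).2 = ∑ i ∈ s, b i := by
      simp [Prod.snd_sum]
    rcases (Finset.sum_nonneg hb.2).eq_or_lt with h0 | h0
    · have hz : ∑ i ∈ s, b i • ((p i, 1) : E × ℝ) = 0 := Finset.sum_eq_zero fun i hi => by
        rw [(Finset.sum_eq_zero_iff_of_nonneg hb.2).1 h0.symm i hi, zero_smul]
      rw [hz, add_zero] at h
      exact hne.1 (eq_of_sub_mem_coneOver he hp.1 ha h)
    · have hu : ∑ i ∈ s, b i • ((p i, 1) : E × ℝ) ∈ coneOver K :=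
        hK.sum_mem_coneOver he s p b hb.2 fun i hi => (hp.2 i hi).1
      set H := ∑ i ∈ s, b i
      -- Removing (p j, 1) requires a coefficient below the height H of the remaining sum; lowering
      -- a is harmless since the claim concerns every positive a.
      set a' := min a (H / 2)
      have ha' : 0 < a' := lt_min ha (by positivity)
      have haa : 0 ≤ a - a' := sub_nonneg.2 (min_le_left _ _)
      refine ih' a' ha' (hd.1.sub_mem_coneOver_of_add hK hp.1.1 hu ha' ?_ (b := b j) ?_)
      · rw [hsnd]
        exact (min_le_right _ _).trans_lt (by linarith)
      · have := hK.add_mem_coneOver h (smul_mem_coneOver he haa)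
        convert this using 1
        rw [sub_smul]
        abel

/-- Pairwise disjoint extreme points are affinely independent. -/
theorem affineIndependent_extremePoints (hK : Convex ℝ K)
    (hd : ∀ e ∈ Set.extremePoints ℝ K, ∀ f ∈ Set.extremePoints ℝ K, e ≠ f → IsConeDisjoint K e f) :
    AffineIndependent ℝ ((↑) : Set.extremePoints ℝ K → E) := by
  classical
  rw [affineIndependent_iff]
  have main : ∀ (s : Finset (Set.extremePoints ℝ K)) (w : Set.extremePoints ℝ K → ℝ),
      s.sum w = 0 → ∑ e ∈ s, w e • (e : E) = 0 → ∀ e ∈ s, w e ≤ 0 := by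
    intro s w hw hwe e he
    by_contra! hpos
    refine sum_sub_notMem_coneOver hK e.2.1 (s.erase e) (fun i => (i : E)) (fun i => max 0 (-w i))
      (fun i _ => le_max_left _ _) (fun i _ => i.2)
      (fun i hi => hd _ e.2 _ i.2 fun h => Finset.ne_of_mem_erase hi (Subtype.ext h.symm))
      (fun i hi h => Finset.ne_of_mem_erase hi (Subtype.ext h.symm)) (w e) hpos ?_
    have hsum : ∑ i ∈ s, w i • (((i : E), 1) : E × ℝ) = 0 := by
      ext <;> simp [Prod.fst_sum, Prod.snd_sum, hw, hwe]
    -- An affine dependence with w e > 0, split by signs, exhibits w e • (e,1) as dominated by the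
    -- generators of negative weight.
    have hsplit : ∑ i ∈ s.erase e, max 0 (-w i) • (((i : E), 1) : E × ℝ) - w e • ((e : E), 1) =
        ∑ i ∈ s.erase e, max 0 (w i) • (((i : E), 1) : E × ℝ) := by
      rw [← Finset.add_sum_erase s _ he] at hsum
      rw [eq_neg_of_add_eq_zero_left hsum, sub_neg_eq_add, ← Finset.sum_add_distrib]
      refine Finset.sum_congr rfl fun i _ => ?_
      rw [← add_smul]
      congr 1
      rcases le_total 0 (w i) with h | h
      · rw [max_eq_left (by linarith), max_eq_right h]; ring
      · rw [max_eq_right (by linarith), max_eq_left h]; ring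
    rw [hsplit]
    exact hK.sum_mem_coneOver e.2.1 _ _ _ (fun i _ => le_max_left _ _) fun i _ => i.2.1
  intro s w hw hwe e he
  refine le_antisymm (main s w hw hwe e he) ?_
  have := main s (fun i => -w i) (by simpa using hw) (by simpa using hwe) e he
  linarith

end Cone

/-! ### Conic covariogram profiles force a simplex. -/

section Simplex

variable {n : ℕ} {K : Set (EuclideanSpace ℝ (Fin n))}

/-- The homothet (1-t)K + ta lies in K ∩ (tX + K), and both have volume (1-t)ⁿ, so they coincide. -/
theorem mem_of_covariogram_smul_eq (hK : IsConvexBody K) (h1 : volume K = 1)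
    {X : EuclideanSpace ℝ (Fin n)}
    (hX : ∀ t : ℝ, 0 < t → covariogram K (t • X) = max 0 (1 - t) ^ n)
    {a : EuclideanSpace ℝ (Fin n)} (ha : a ∈ K) (haX : a - X ∈ K) {t : ℝ} (ht : 0 < t) (ht1 : t < 1)
    {y : EuclideanSpace ℝ (Fin n)} (hy : y ∈ K) (hyX : y - t • X ∈ K) :
    ∃ q ∈ K, y = (1 - t) • q + t • a := by
  set A := (fun z => z + t • a) '' ((1 - t) • K) with hA
  have ht2 : 0 < 1 - t := sub_pos.2 ht1
  have hAc : IsCompact A := (hK.1.smul _).image (by fun_prop)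
  have hsub : A ⊆ {y | y ∈ K ∧ y - t • X ∈ K} := by
    rintro _ ⟨_, ⟨q, hq, rfl⟩, rfl⟩
    have := hK.2.1.combo_mem_inter_sub_mem (x := 0) (y := X) ⟨hq, by rwa [sub_zero]⟩ ⟨ha, haX⟩
      ht2.le ht.le (by ring)
    rwa [smul_zero, zero_add] at this
  have hvol : volume.real A = (1 - t) ^ n := by
    rw [hA, Set.image_add_right, Measure.real, measure_preimage_add_right]
    change volume.real _ = _
    rw [volume_real_smul ht2.le, Measure.real, h1, ENNReal.toReal_one, mul_one]
  have hB : IsConvexBody {y | y ∈ K ∧ y - t • X ∈ K} := by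
    refine ⟨isCompact_inter_sub_mem hK.1 _, convex_inter_sub_mem hK.2.1 _, ?_⟩
    refine Set.Nonempty.mono (interior_mono hsub) ?_
    rw [hA, ← Homeomorph.coe_addRight, ← Homeomorph.image_interior, interior_smul₀ ht2.ne']
    exact hK.2.2.smul_set.image _
  have heq : A = {y | y ∈ K ∧ y - t • X ∈ K} := by
    refine eq_of_subset_of_volume_eq hAc.isClosed hB hsub ?_
    rw [← ofReal_measureReal hAc.measure_lt_top.ne, ← ofReal_measureReal hB.1.measure_lt_top.ne,
      hvol, ← covariogram_eq, hX t ht, max_eq_right ht2.le]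
  obtain ⟨_, ⟨q, hq, rfl⟩, h⟩ := heq.symm.subset ⟨hy, hyX⟩
  exact ⟨q, hq, h.symm⟩

/-- For t < 1 the covariogram is positive at tX, so tX ∈ K - K; this set is closed and t tends to 1.
-/
theorem exists_mem_sub_mem (hK : IsConvexBody K) {X : EuclideanSpace ℝ (Fin n)}
    (hX : ∀ t : ℝ, 0 < t → covariogram K (t • X) = max 0 (1 - t) ^ n) :
    ∃ a ∈ K, a - X ∈ K := by
  have hcl : IsClosed (K - K) := by
    rw [sub_eq_add_neg]
    exact (IsCompact.add hK.1 (IsCompact.neg hK.1)).isClosed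
  have hlim : Filter.Tendsto (fun t : ℝ => t • X) (nhdsWithin 1 (Set.Iio 1)) (nhds ((1 : ℝ) • X)) :=
    ((continuous_id.smul continuous_const).tendsto (1 : ℝ)).mono_left nhdsWithin_le_nhds
  rw [one_smul] at hlim
  have hmem : X ∈ K - K := by
    refine hcl.mem_of_tendsto hlim ?_
    filter_upwards [Ioo_mem_nhdsLT (zero_lt_one' ℝ)] with t ht
    obtain ⟨y, hy, hy'⟩ := nonempty_of_covariogram_ne_zero (K := K) (x := t • X) (by
      have : 0 < 1 - t := sub_pos.2 ht.2
      rw [hX t ht.1, max_eq_right this.le]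
      positivity)
    exact ⟨y, hy, y - t • X, hy', by simp⟩
  obtain ⟨a, ha, b, hb, rfl⟩ := hmem
  exact ⟨a, ha, by simpa using hb⟩

/-- Once s = 1 is known, that is, the profile in direction e - f vanishes exactly from t = 1 on, the
homothety description with a = e is the disjointness of e and f. -/
theorem isConeDisjoint_of_covariogram (hK : IsConvexBody K) (h1 : volume K = 1)
    (hcone : ∀ x ≠ 0, ∃ s > 0, ∀ t, 0 < t → covariogram K (t • x) = coneProfile n s t)
    {e f : EuclideanSpace ℝ (Fin n)} (he : e ∈ Set.extremePoints ℝ K)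
    (hf : f ∈ Set.extremePoints ℝ K) (hef : e ≠ f) : IsConeDisjoint K e f := by
  obtain ⟨s, hs, hcs⟩ := hcone (e - f) (sub_ne_zero.2 hef)
  set X := s • (e - f) with hXd
  have hX : ∀ t : ℝ, 0 < t → covariogram K (t • X) = max 0 (1 - t) ^ n := by
    intro t ht
    rw [hXd, smul_smul, hcs _ (by positivity), coneProfile, mul_div_cancel_right₀ _ hs.ne']
  have hX' : ∀ t : ℝ, 0 < t → covariogram K (t • -X) = max 0 (1 - t) ^ n := by
    intro t ht
    rw [smul_neg, covariogram_neg, hX t ht]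
  have hefX : e - f = s⁻¹ • X := by rw [hXd, smul_smul, inv_mul_cancel₀ hs.ne', one_smul]
  have extreme {z q a : EuclideanSpace ℝ (Fin n)} (hz : z ∈ Set.extremePoints ℝ K) (hq : q ∈ K)
      (ha : a ∈ K) {t : ℝ} (ht : 0 < t) (ht1 : t < 1) (h : z = (1 - t) • q + t • a) : a = z :=
    ((mem_extremePoints.1 hz).2 q hq a ha
      ⟨1 - t, t, sub_pos.2 ht1, ht, by ring, h.symm⟩).2
  have hs1 : s = 1 := by
    -- If s < 1, the homothety description for -X writes f as the midpoint of a point of K and e -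
    -- X, so extremality gives e - X = f. If s > 1, take a chord from a - X to a in K: then e is a
    -- proper combination involving a, and f one involving a - X, so a = e and a - X = f. Either way
    -- X = e - f, contradicting s ≠ 1.
    rcases lt_trichotomy s 1 with h | h | h
    · exfalso
      have heX : e - X ∈ K := by
        have := hK.2.1 hf.1 he.1 hs.le (sub_nonneg.2 h.le) (by ring)
        convert this using 1
        rw [hXd, smul_sub, sub_smul, one_smul]
        abel
      obtain ⟨q, hq, hfq⟩ := mem_of_covariogram_smul_eq hK h1 hX' (a := e - X) (y := f)
        (t := 1 / 2) heX (by simpa using he.1) (by norm_num) (by norm_num) hf.1 (by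
          have := hK.2.1 hf.1 he.1 (show (0 : ℝ) ≤ 1 - s / 2 by linarith)
            (show 0 ≤ s / 2 by linarith) (by ring)
          convert this using 1
          rw [hXd, smul_neg, sub_neg_eq_add, smul_smul, smul_sub, sub_smul, one_smul,
            show (1 / 2 : ℝ) * s = s / 2 by ring]
          abel)
      have h2 := extreme hf hq heX (by norm_num) (by norm_num) hfq
      have h3 : (1 - s) • (e - f) = 0 := by
        rw [sub_smul, one_smul, ← hXd, ← h2]
        abel
      exact (smul_ne_zero (sub_ne_zero.2 h.ne') (sub_ne_zero.2 hef)) h3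
    · exact h
    · exfalso
      have hτ : 0 < s⁻¹ := by positivity
      have hτ1 : s⁻¹ < 1 := inv_lt_one_of_one_lt₀ h
      obtain ⟨a, ha, haX⟩ := exists_mem_sub_mem hK hX
      obtain ⟨q, hq, heq⟩ := mem_of_covariogram_smul_eq hK h1 hX ha haX hτ hτ1 he.1 (by
        rw [← hefX, sub_sub_cancel]; exact hf.1)
      have hae := extreme he hq ha hτ hτ1 heq
      obtain ⟨q', hq', hfq⟩ := mem_of_covariogram_smul_eq hK h1 hX' haX (by simpa using ha) hτ hτ1
        hf.1 (by rw [smul_neg, ← hefX, sub_neg_eq_add, add_sub_cancel]; exact he.1)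
      have hbf := extreme hf hq' haX hτ hτ1 hfq
      have h3 : (1 - s) • (e - f) = 0 := by
        rw [sub_smul, one_smul, ← hXd, ← hbf, ← hae]
        abel
      exact (smul_ne_zero (sub_ne_zero.2 h.ne) (sub_ne_zero.2 hef)) h3
  intro t ht ht1 y hy hyt
  refine mem_of_covariogram_smul_eq hK h1 hX he.1 ?_ ht ht1 hy ?_
  · rw [hXd, hs1, one_smul, sub_sub_cancel]; exact hf.1
  · rwa [hXd, hs1, one_smul]

/-- A convex body whose covariogram has conic profiles in all directions is a simplex. -/
theorem exists_simplex_of_covariogram (hK : IsConvexBody K) (h1 : volume K = 1)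
    (hcone : ∀ x ≠ 0, ∃ s > 0, ∀ t, 0 < t → covariogram K (t • x) = coneProfile n s t) :
    ∃ s : Affine.Simplex ℝ (EuclideanSpace ℝ (Fin n)) n, K = convexHull ℝ (Set.range s.points) := by
  have hind := affineIndependent_extremePoints hK.2.1 fun e he f hf hef =>
    isConeDisjoint_of_covariogram hK h1 hcone he hf hef
  have hfin : (Set.extremePoints ℝ K).Finite := finite_set_of_fin_dim_affineIndependent ℝ hind
  have hhull : convexHull ℝ (Set.extremePoints ℝ K) = K := by
    rw [← (hfin.isCompact_convexHull ℝ).isClosed.closure_eq]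
    exact closure_convexHull_extremePoints hK.1 hK.2.1
  have hspan : affineSpan ℝ (Set.extremePoints ℝ K) = ⊤ := by
    rw [← interior_convexHull_nonempty_iff_affineSpan_eq_top, hhull]
    exact hK.2.2
  have := hfin.fintype
  have hcard : Fintype.card (Set.extremePoints ℝ K) = n + 1 := by
    have := hind.affineSpan_eq_top_iff_card_eq_finrank_add_one.1 (by rwa [Subtype.range_coe])
    rwa [finrank_euclideanSpace_fin] at this
  let φ : Fin (n + 1) ≃ Set.extremePoints ℝ K := (Fintype.equivFinOfCardEq hcard).symm
  refine ⟨⟨fun i => φ i, hind.comp_embedding φ.toEmbedding⟩, ?_⟩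
  have : Set.range (fun i => (φ i : EuclideanSpace ℝ (Fin n))) = Set.extremePoints ℝ K := by
    rw [show (fun i => (φ i : EuclideanSpace ℝ (Fin n))) = Subtype.val ∘ φ from rfl,
      φ.surjective.range_comp, Subtype.range_coe]
  rw [this, hhull]

end Simplex

/-! ### Isotropic simplices are regular, and simplices have conic profiles. -/

section RegularSimplex

variable {n : ℕ} {K : Set (EuclideanSpace ℝ (Fin n))} {L : ℝ}

/-- The affine basis formed by the vertices of a simplex of full dimension. -/
noncomputable def Affine.Simplex.affineBasis (s : Affine.Simplex ℝ (EuclideanSpace ℝ (Fin n)) n) :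
    AffineBasis (Fin (n + 1)) ℝ (EuclideanSpace ℝ (Fin n)) :=
  ⟨s.points, s.independent, s.span_eq_top finrank_euclideanSpace_fin⟩

theorem AffineBasis.exists_affineEquiv {ι V : Type*} [AddCommGroup V] [Module ℝ V]
    (b b' : AffineBasis ι ℝ V) (i : ι) : ∃ A : V ≃ᵃ[ℝ] V, ∀ j, A (b j) = b' j := by
  let T : V ≃ₗ[ℝ] V := (b.basisOf i).equiv (b'.basisOf i) (Equiv.refl _)
  refine ⟨(AffineEquiv.vaddConst ℝ (b i)).symm.trans
    (T.toAffineEquiv.trans (AffineEquiv.vaddConst ℝ (b' i))), fun j => ?_⟩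
  by_cases hj : j = i
  · subst hj; simp
  · have h := (b.basisOf i).equiv_apply ⟨j, hj⟩ (b'.basisOf i) (Equiv.refl _)
    rw [Equiv.refl_apply, AffineBasis.basisOf_apply, AffineBasis.basisOf_apply] at h
    have h' : T (b j - b i) = b' j - b' i := h
    simp [h']

/-- The affine map inducing a permutation of the vertices maps the isotropic body K onto itself, so
its linear part is an isometry; every permutation therefore preserves the distances between
vertices. -/
theorem IsIsotropicWith.equilateral (hn : n ≠ 0) (hK : IsIsotropicWith K L)
    (s : Affine.Simplex ℝ (EuclideanSpace ℝ (Fin n)) n) (hs : K = convexHull ℝ (Set.range s.points)) :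
    s.Equilateral := by
  have key : ∀ (σ : Equiv.Perm (Fin (n + 1))) (i j : Fin (n + 1)),
      dist (s.points (σ i)) (s.points (σ j)) = dist (s.points i) (s.points j) := by
    intro σ i j
    obtain ⟨A, hA⟩ := s.affineBasis.exists_affineEquiv (s.affineBasis.reindex σ.symm) 0
    have hA' : ∀ j, A (s.points j) = s.points (σ j) := fun j => by
      have := hA j
      rwa [AffineBasis.reindex_apply, Equiv.symm_symm] at this
    have himg : A '' K = K := by
      have h1 : A '' Set.range s.points = Set.range s.points := by
        rw [← Set.range_comp, show A ∘ s.points = s.points ∘ σ from funext hA',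
          σ.surjective.range_comp]
      have h2 := AffineMap.image_convexHull A.toAffineMap (Set.range s.points)
      rw [hs]
      exact h2.trans (congrArg _ h1)
    have hiso := (hK.eq_and_norm_map hn A (L' := L) (by rwa [himg])).2
    rw [← hA', ← hA', dist_eq_norm, dist_eq_norm, ← hiso (s.points i - s.points j),
      A.eq_linear_add (s.points i), A.eq_linear_add (s.points j), map_sub, add_sub_add_right_eq_sub]
  have h01 : (0 : Fin (n + 1)) ≠ Fin.last n := by
    simpa [Fin.ext_iff] using hn.symm
  refine ⟨dist (s.points 0) (s.points (Fin.last n)), fun i j hij => ?_⟩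
  -- Two transpositions move the pair (i, j) to (0, j') and then to (0, `Fin.last n`).
  set j' := Equiv.swap 0 i j with hj'
  have hj0 : j' ≠ 0 := by
    intro h
    have h2 : Equiv.swap 0 i i = Equiv.swap 0 i j := by rw [Equiv.swap_apply_right, ← hj', h]
    exact hij ((Equiv.swap 0 i).injective h2)
  rw [← key (Equiv.swap 0 i) i j, Equiv.swap_apply_right, ← hj',
    ← key (Equiv.swap j' (Fin.last n)) 0 j', Equiv.swap_apply_left,
    Equiv.swap_apply_of_ne_of_ne hj0.symm h01]

theorem AffineMap.apply_sub_smul {V : Type*} [AddCommGroup V] [Module ℝ V] (f : V →ᵃ[ℝ] ℝ)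
    (y x : V) (t : ℝ) : f (y - t • x) = f y - t * (f x - f 0) := by
  rw [f.decomp]
  simp
  ring

/-- The covariogram of a simplex of volume `1` has conic profiles. -/
theorem covariogram_convexHull_affineBasis (hn : n ≠ 0)
    (b : AffineBasis (Fin (n + 1)) ℝ (EuclideanSpace ℝ (Fin n)))
    (hK : K = convexHull ℝ (Set.range b)) (h1 : volume K = 1) {x : EuclideanSpace ℝ (Fin n)}
    (hx : x ≠ 0) : ∃ s > 0, ∀ t, 0 < t → covariogram K (t • x) = coneProfile n s t := by
  have hmemK : ∀ y, y ∈ K ↔ ∀ i, 0 ≤ b.coord i y := by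
    intro y; rw [hK, b.convexHull_eq_nonneg_coord]; rfl
  -- δ i is the increment of the i-th barycentric coordinate along x. Hence K ∩ (tx + K) is cut out
  -- by coord i ≥ t max(0, δ i), and the cone has extent 1/M, with M the sum of these positive
  -- parts.
  set δ : Fin (n + 1) → ℝ := fun i => b.coord i x - b.coord i 0 with hδ
  have hδsum : ∑ i, δ i = 0 := by
    simp [hδ, Finset.sum_sub_distrib, b.sum_coord_apply_eq_one]
  set m : Fin (n + 1) → ℝ := fun i => max 0 (δ i) with hm
  have hm0 : ∀ i, 0 ≤ m i := fun i => le_max_left _ _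
  set M := ∑ i, m i with hM
  have hM0 : 0 < M := by
    refine lt_of_le_of_ne (Finset.sum_nonneg fun i _ => hm0 i) fun h => hx ?_
    have hmz : ∀ i, m i = 0 := fun i =>
      (Finset.sum_eq_zero_iff_of_nonneg fun i _ => hm0 i).1 h.symm i (Finset.mem_univ i)
    have hle : ∀ i, δ i ≤ 0 := fun i => (le_max_right _ _).trans (hmz i).le
    have hz : ∀ i, δ i = 0 := fun i =>
      (Finset.sum_eq_zero_iff_of_nonpos fun i _ => hle i).1 hδsum i (Finset.mem_univ i)
    exact b.ext_elem fun i => sub_eq_zero.1 (hz i)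
  have hset : ∀ t : ℝ, 0 < t → {y | y ∈ K ∧ y - t • x ∈ K} = {y | ∀ i, t * m i ≤ b.coord i y} := by
    intro t ht
    ext y
    change (y ∈ K ∧ y - t • x ∈ K) ↔ ∀ i, t * m i ≤ b.coord i y
    rw [hmemK, hmemK, ← forall_and]
    refine forall_congr' fun i => ?_
    rw [AffineMap.apply_sub_smul, hm, mul_max_of_nonneg _ _ ht.le, mul_zero, max_le_iff, sub_nonneg]
  refine ⟨M⁻¹, by positivity, fun t ht => ?_⟩
  rw [covariogram_eq, hset t ht, coneProfile, div_inv_eq_mul]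
  have hsumt : ∑ i, t * m i = t * M := by rw [hM, Finset.mul_sum]
  rcases lt_or_ge (t * M) 1 with h | h
  · have hc : 0 < 1 - t * M := sub_pos.2 h
    -- The weights m j sum to M, so q ↦ (1 - tM)q + tw multiplies each coordinate by 1 - tM and adds
    -- t m i: the intersection is a homothet of K.
    set w := ∑ j, m j • b j with hw
    have hcoord : ∀ q i, b.coord i ((1 - t * M) • q + t • w) = (1 - t * M) * b.coord i q + t * m i := by
      intro q i
      have lin : ∀ y, b.coord i y = (b.coord i).linear y + b.coord i 0 := fun y => by
        conv_lhs => rw [AffineMap.decomp (b.coord i)]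
        rfl
      have hlinw : (b.coord i).linear w = m i - M * b.coord i 0 := by
        rw [hw, map_sum, hM, Finset.sum_mul]
        have : ∀ j, (b.coord i).linear (m j • b j) =
            m j * (if i = j then 1 else 0) - m j * b.coord i 0 := by
          intro j
          rw [map_smul, smul_eq_mul, ← b.coord_apply, lin (b j)]
          ring
        simp_rw [this]
        rw [Finset.sum_sub_distrib]
        simp
      rw [lin, lin q, map_add, map_smul, map_smul, hlinw, smul_eq_mul, smul_eq_mul]
      ring
    have himg : {y | ∀ i, t * m i ≤ b.coord i y} = (fun z => z + t • w) '' ((1 - t * M) • K) := by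
      ext y
      constructor
      · intro hy
        refine ⟨y - t • w, ?_, sub_add_cancel _ _⟩
        rw [Set.mem_smul_set_iff_inv_smul_mem₀ hc.ne', hmemK]
        intro i
        have h2 := hcoord ((1 - t * M)⁻¹ • (y - t • w)) i
        rw [smul_smul, mul_inv_cancel₀ hc.ne', one_smul, sub_add_cancel] at h2
        have h3 : 0 ≤ (1 - t * M) * b.coord i ((1 - t * M)⁻¹ • (y - t • w)) := by
          have := hy i
          linarith
        exact nonneg_of_mul_nonneg_right h3 hc
      · rintro ⟨_, ⟨q, hq, rfl⟩, rfl⟩ i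
        have h2 := hcoord q i
        simp only
        rw [h2]
        have := mul_nonneg hc.le ((hmemK q).1 hq i)
        linarith
    rw [himg, Set.image_add_right, Measure.real, measure_preimage_add_right]
    change volume.real _ = _
    rw [volume_real_smul hc.le, Measure.real, h1, ENNReal.toReal_one, mul_one, max_eq_right hc.le]
  -- The coordinates sum to 1 while their lower bounds sum to tM ≥ 1, so at most one point remains.
  · have hsub : {y | ∀ i, t * m i ≤ b.coord i y}.Subsingleton := by
      have fix : ∀ y, (∀ i, t * m i ≤ b.coord i y) → ∀ i, b.coord i y = t * m i := by
        intro y hy i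
        have hle : ∑ i, (b.coord i y - t * m i) ≤ 0 := by
          rw [Finset.sum_sub_distrib, b.sum_coord_apply_eq_one, hsumt]
          linarith
        have hnn : ∀ i ∈ Finset.univ, 0 ≤ b.coord i y - t * m i := fun i _ => sub_nonneg.2 (hy i)
        have := (Finset.sum_eq_zero_iff_of_nonneg hnn).1 (le_antisymm hle (Finset.sum_nonneg hnn)) i
          (Finset.mem_univ i)
        linarith
      intro y hy z hz
      exact b.ext_elem fun i => (fix y hy i).trans (fix z hz i).symm
    have : NeZero n := ⟨hn⟩
    rw [Measure.real, hsub.measure_zero, ENNReal.toReal_zero, max_eq_left (by linarith), zero_pow hn]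

end RegularSimplex

/-! ### The constants -/

theorem centralBinom_ratio (n : ℕ) :
    ((2 * n + 2).choose n : ℝ) * (n + 2) = (2 * n).choose n * (2 * (2 * n + 1)) := by
  have h1 := Nat.add_one_mul_choose_eq (2 * n + 1) n
  have h2 := Nat.add_one_mul_choose_eq (2 * n) n
  have h3 := Nat.choose_succ_right_eq (2 * n + 2) n
  have h4 := Nat.choose_succ_right_eq (2 * n + 1) n
  rw [show 2 * n + 2 - n = n + 2 by omega] at h3
  rw [show 2 * n + 1 - n = n + 1 by omega] at h4
  rify at h1 h2 h3 h4
  have hn : (n + 1 : ℝ) ≠ 0 := by positivity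
  apply mul_right_cancel₀ hn
  linear_combination (-(n + 1) : ℝ) * h3 - (n + 1 : ℝ) * h1 - 2 * (n + 1 : ℝ) * h4 -
    2 * (n + 1 : ℝ) * h2

theorem slicingConst_sq {n : ℕ} (hn : n ≠ 0) : slicingConst n ^ 2 =
    ((2 * n).choose n : ℝ) ^ (2 / (n : ℝ)) * (n + 2) / (4 * (2 * n + 1)) := by
  have hC : (0 : ℝ) < (2 * n).choose n := by
    exact_mod_cast Nat.choose_pos (by omega)
  have hC2 : (0 : ℝ) < (2 * n + 2).choose n := by
    exact_mod_cast Nat.choose_pos (by omega)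
  have hr := centralBinom_ratio n
  have hn0 : (0 : ℝ) < n := by exact_mod_cast Nat.pos_of_ne_zero hn
  rw [slicingConst, mul_pow, div_pow, div_pow, Real.sq_sqrt zero_le_two, one_pow,
    ← Real.rpow_natCast, ← Real.rpow_natCast, ← Real.rpow_mul hC.le, ← Real.rpow_mul hC2.le,
    show ((1 : ℝ) / 2 + 1 / n) * (2 : ℕ) = 1 + 2 / n by push_cast; ring,
    show ((1 : ℝ) / 2) * (2 : ℕ) = 1 by norm_num, Real.rpow_add hC, Real.rpow_one, Real.rpow_one]
  have e : ((2 * n + 2).choose n : ℝ) = (2 * n).choose n * (2 * (2 * n + 1)) / (n + 2) := by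
    rw [eq_div_iff (by positivity)]; exact hr
  rw [e]
  field_simp
  ring

theorem slicingConst_pos (n : ℕ) : 0 < slicingConst n := by
  have hC : (0 : ℝ) < (2 * n).choose n := by
    exact_mod_cast Nat.choose_pos (by omega)
  have hC2 : (0 : ℝ) < (2 * n + 2).choose n := by
    exact_mod_cast Nat.choose_pos (by omega)
  unfold slicingConst
  positivity

/-- There is equality at n = 2, and the bound fails at n = 1. -/
theorem centralBinom_mul_eight_le {n : ℕ} (hn : 2 ≤ n) : 8 * (2 * n).choose n ≤ 3 * 4 ^ n := by
  induction n, hn using Nat.le_induction with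
  | base => decide
  | succ n hn ih =>
    have h := Nat.succ_mul_centralBinom_succ n
    rw [Nat.centralBinom, Nat.centralBinom] at h
    have h1 : (n + 1) * (8 * (2 * (n + 1)).choose (n + 1)) ≤ (n + 1) * (3 * 4 ^ (n + 1)) := by
      calc (n + 1) * (8 * (2 * (n + 1)).choose (n + 1))
          = 2 * (2 * n + 1) * (8 * (2 * n).choose n) := by linarith
        _ ≤ 2 * (2 * n + 1) * (3 * 4 ^ n) := by gcongr
        _ ≤ (n + 1) * (3 * 4 ^ (n + 1)) := by rw [pow_succ]; nlinarith [Nat.pow_pos (n := n) (show 0 < 4 by norm_num)]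
    exact Nat.le_of_mul_le_mul_left h1 (Nat.succ_pos n)

/-- The claim is C(2n,n)² ≤ xⁿ with x = 8(2n+1)/(n+2), and x(1 + 3/(2n+1)) = 16. For n ≥ 2 the bound
C(2n,n) ≤ (3/8)4ⁿ leaves (1 + 3/(2n+1))ⁿ ≤ 64/9, which holds since the left side is at most e^(3/2).
-/
theorem slicingConst_le {n : ℕ} (hn : n ≠ 0) : slicingConst n ≤ √2 := by
  have hn0 : (0 : ℝ) < n := by exact_mod_cast Nat.pos_of_ne_zero hn
  have hC : (0 : ℝ) < (2 * n).choose n := by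
    exact_mod_cast Nat.choose_pos (by omega)
  refine Real.le_sqrt_of_sq_le ?_
  rw [slicingConst_sq hn, div_le_iff₀ (by positivity), ← le_div_iff₀ (by positivity)]
  set x : ℝ := 2 * (4 * (2 * n + 1)) / (n + 2) with hx
  have hx0 : 0 < x := by positivity
  have key : ((2 * n).choose n : ℝ) ^ 2 ≤ x ^ n := by
    rcases Nat.lt_or_ge n 2 with h | h
    · have : n = 1 := by omega
      subst this
      norm_num [hx]
    · have h8 : (8 : ℝ) * (2 * n).choose n ≤ 3 * 4 ^ n := by
        exact_mod_cast centralBinom_mul_eight_le h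
      have hexp : (1 + 3 / (2 * n + 1) : ℝ) ^ n ≤ 64 / 9 := by
        have h1 : (1 + 3 / (2 * n + 1) : ℝ) ≤ Real.exp (3 / (2 * n + 1)) := by
          have := Real.add_one_le_exp (3 / (2 * n + 1) : ℝ)
          linarith
        calc (1 + 3 / (2 * n + 1) : ℝ) ^ n ≤ Real.exp (3 / (2 * n + 1)) ^ n := by gcongr
          _ = Real.exp (n * (3 / (2 * n + 1))) := (Real.exp_nat_mul _ _).symm
          _ ≤ Real.exp (3 / 2) := by
            gcongr
            rw [mul_div_assoc', div_le_div_iff₀ (by positivity) (by norm_num)]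
            linarith
          _ ≤ 64 / 9 := by
            have h2 : Real.exp (3 / 2) ^ 2 = Real.exp 1 ^ 3 := by
              rw [← Real.exp_nat_mul, ← Real.exp_nat_mul]; norm_num
            have h3 : Real.exp 1 < 3 := Real.exp_one_lt_three
            have h4 : Real.exp 1 ^ 3 ≤ 3 ^ 3 := by gcongr
            nlinarith [Real.exp_pos (3 / 2)]
      have h16 : x * (1 + 3 / (2 * n + 1)) = 16 := by rw [hx]; field_simp; ring
      have hpow : x ^ n * (1 + 3 / (2 * n + 1) : ℝ) ^ n = 16 ^ n := by rw [← mul_pow, h16]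
      have hxn : 0 < x ^ n := by positivity
      have h5 : (16 : ℝ) ^ n ≤ x ^ n * (64 / 9) := by
        rw [← hpow]; gcongr
      have h6 : (64 : ℝ) * ((2 * n).choose n : ℝ) ^ 2 ≤ 9 * 16 ^ n := by
        have : ((8 : ℝ) * (2 * n).choose n) ^ 2 ≤ (3 * 4 ^ n) ^ 2 := by gcongr
        rw [mul_pow, mul_pow, ← pow_mul, mul_comm n 2, pow_mul] at this
        norm_num at this ⊢
        exact this
      linarith
  calc ((2 * n).choose n : ℝ) ^ (2 / (n : ℝ)) = (((2 * n).choose n : ℝ) ^ 2) ^ (n : ℝ)⁻¹ := by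
        rw [← Real.rpow_natCast, ← Real.rpow_mul hC.le]; congr 1
    _ ≤ (x ^ n) ^ (n : ℝ)⁻¹ := by gcongr
    _ = x := Real.pow_rpow_inv_natCast hx0.le hn

/-- Squeezed between the bound coming from C(2n,n) ≥ 4ⁿ/(2n), where (2n)^(1/n) tends to 1, and the
constant 2. -/
theorem tendsto_slicingConst_sq :
    Filter.Tendsto (fun n : ℕ => slicingConst n ^ 2) Filter.atTop (nhds 2) := by
  have hlow : Filter.Tendsto (fun n : ℕ => ((16 : ℝ) / ((2 * (n : ℝ)) ^ (1 / (n : ℝ))) ^ 2) *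
      (n + 2) / (4 * (2 * n + 1))) Filter.atTop (nhds 2) := by
    have h2n : Filter.Tendsto (fun n : ℕ => 2 * (n : ℝ)) Filter.atTop Filter.atTop :=
      tendsto_natCast_atTop_atTop.const_mul_atTop zero_lt_two
    have h1 : Filter.Tendsto (fun n : ℕ => (2 * (n : ℝ)) ^ (1 / (n : ℝ))) Filter.atTop (nhds 1) := by
      refine ((tendsto_rpow_div_mul_add 2 1 0 zero_ne_one).comp h2n).congr fun n => ?_
      simp only [Function.comp_apply]
      congr 1
      rw [one_mul, add_zero, ← div_div, div_self two_ne_zero]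
    have h2 : Filter.Tendsto (fun n : ℕ => (1 : ℝ) / 8 + 3 / 8 / (2 * n + 1)) Filter.atTop
        (nhds (1 / 8 + 0)) :=
      tendsto_const_nhds.add (tendsto_const_nhds.div_atTop
        (Filter.tendsto_atTop_add_const_right _ _ h2n))
    have h3 := (((tendsto_const_nhds (x := (16 : ℝ))).div (h1.pow 2) (by norm_num)).mul h2)
    rw [show (16 : ℝ) / 1 ^ 2 * (1 / 8 + 0) = 2 by norm_num] at h3
    refine h3.congr fun n => ?_
    simp only [Pi.div_apply]
    rw [mul_div_assoc]
    congr 1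
    field_simp
    ring
  refine tendsto_of_tendsto_of_tendsto_of_le_of_le' hlow tendsto_const_nhds ?_ ?_
  · filter_upwards [Filter.eventually_ge_atTop 1] with n hn
    have hn' : n ≠ 0 := by omega
    have hn0 : (0 : ℝ) < n := by exact_mod_cast hn
    have hC : (0 : ℝ) < (2 * n).choose n := by
      exact_mod_cast Nat.choose_pos (by omega)
    rw [slicingConst_sq hn']
    gcongr
    have h4 : (4 : ℝ) ^ n ≤ 2 * n * (2 * n).choose n := by
      exact_mod_cast Nat.four_pow_le_two_mul_self_mul_centralBinom n hn
    calc (16 : ℝ) / ((2 * (n : ℝ)) ^ (1 / (n : ℝ))) ^ 2 = ((4 ^ n / (2 * n)) ^ (n : ℝ)⁻¹) ^ 2 := by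
          rw [Real.div_rpow (by positivity) (by positivity),
            Real.pow_rpow_inv_natCast (by norm_num) hn', div_pow, one_div]
          norm_num
      _ ≤ (((2 * n).choose n : ℝ) ^ (n : ℝ)⁻¹) ^ 2 := by
          gcongr
          rw [div_le_iff₀ (by positivity)]
          linarith
      _ = _ := by
          rw [← Real.rpow_natCast (_ ^ _), ← Real.rpow_mul hC.le]
          congr 1
          push_cast
          ring
  · filter_upwards [Filter.eventually_ge_atTop 1] with n hn
    have h := slicingConst_le (n := n) (by omega)
    calc slicingConst n ^ 2 ≤ √2 ^ 2 := by
          have := (slicingConst_pos n).le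
          gcongr
      _ = 2 := Real.sq_sqrt zero_le_two

theorem isLUB_slicingConst : IsLUB {d : ℝ | ∃ n : ℕ, 1 ≤ n ∧ d = slicingConst n} √2 := by
  refine ⟨?_, fun u hu => ?_⟩
  · rintro _ ⟨n, hn, rfl⟩
    exact slicingConst_le (by omega)
  · have hu0 : 0 ≤ u := (slicingConst_pos 1).le.trans (hu ⟨1, le_rfl, rfl⟩)
    refine (Real.sqrt_le_left hu0).2 (le_of_tendsto tendsto_slicingConst_sq ?_)
    filter_upwards [Filter.eventually_ge_atTop 1] with n hn
    have := hu ⟨n, hn, rfl⟩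
    have h0 := (slicingConst_pos n).le
    gcongr

/-! ### The comparison of isotropic constants -/

/-- The factor by which the volume of Ball's body enters the comparison of isotropic constants. -/
theorem slicingConst_mul_rpow {n : ℕ} (hn : n ≠ 0) {σ V : ℝ} (hσ : 0 < σ)
    (hσ' : σ ^ (n + 2) = (2 * n + 2).choose n) (hV : 0 ≤ V) :
    slicingConst n * (√2 * V ^ (-((1 : ℝ) / 2 + 1 / n))) =
      (σ ^ n / (2 * n).choose n * V) ^ (-((1 : ℝ) / 2 + 1 / n)) := by
  have hn0 : (n : ℝ) ≠ 0 := Nat.cast_ne_zero.2 hn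
  have hC : (0 : ℝ) < (2 * n).choose n := by
    exact_mod_cast Nat.choose_pos (by omega)
  have h2 : √2 ≠ 0 := by positivity
  have key : (σ ^ n) ^ ((1 : ℝ) / 2 + 1 / n) = ((2 * n + 2).choose n : ℝ) ^ ((1 : ℝ) / 2) := by
    rw [← hσ', ← Real.rpow_natCast σ n, ← Real.rpow_natCast σ (n + 2), ← Real.rpow_mul hσ.le,
      ← Real.rpow_mul hσ.le]
    congr 1
    push_cast
    field_simp
  rw [Real.mul_rpow (by positivity) hV, Real.rpow_neg (x := σ ^ n / _) (by positivity),
    Real.div_rpow (by positivity) hC.le, key, inv_div, slicingConst]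
  field_simp

theorem theorem1p1 :
    (∀ n : ℕ, 1 ≤ n → ∀ K : Set (EuclideanSpace ℝ (Fin n)), IsIsotropic K →
      isotropicConstant K ≤
          slicingConst n * isotropicConstant (ballBody ((n : ℝ) + 2) (covariogram K)) ∧
        (isotropicConstant K =
            slicingConst n * isotropicConstant (ballBody ((n : ℝ) + 2) (covariogram K)) ↔
          IsRegularSimplex K)) ∧
      IsLUB {d : ℝ | ∃ n : ℕ, 1 ≤ n ∧ d = slicingConst n} √2 := by
  refine ⟨fun n hn1 K ⟨L, hK⟩ => ?_, isLUB_slicingConst⟩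
  have hn : n ≠ 0 := by omega
  have hC2 : (0 : ℝ) < (2 * n + 2).choose n := by
    exact_mod_cast Nat.choose_pos (by omega)
  have hC : (0 : ℝ) < (2 * n).choose n := by
    exact_mod_cast Nat.choose_pos (by omega)
  obtain ⟨σ, hσ, hσ'⟩ : ∃ σ : ℝ, 0 < σ ∧ σ ^ (n + 2) = (2 * n + 2).choose n :=
    ⟨_, Real.rpow_pos_of_pos hC2 _, Real.rpow_inv_natCast_pow hC2.le (n := n + 2) (by omega)⟩
  obtain ⟨hle, heq⟩ := volume_ballBody_covariogram_le hn hK.convexBody hK.volume_eq_one hσ hσ'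
  have hT : IsConvexBody (ballBody ((n : ℝ) + 2) (covariogram K)) :=
    (isLogConcaveDensity_covariogram hK.convexBody hK.volume_eq_one).isConvexBody_ballBody
      (by positivity)
  have hV : 0 < volume.real (ballBody ((n : ℝ) + 2) (covariogram K)) := ENNReal.toReal_pos
    ((isOpen_interior.measure_pos volume hT.2.2).trans_le (measure_mono interior_subset)).ne'
    hT.1.measure_lt_top.ne
  have hconst : slicingConst n * isotropicConstant (ballBody ((n : ℝ) + 2) (covariogram K)) =
      L * (σ ^ n / (2 * n).choose n * volume.real (ballBody ((n : ℝ) + 2) (covariogram K))) ^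
        (-((1 : ℝ) / 2 + 1 / n)) := by
    rw [hK.isotropicConstant_ballBody hn, ← slicingConst_mul_rpow hn hσ hσ' hV.le]
    ring
  have hexp : -((1 : ℝ) / 2 + 1 / n) < 0 := neg_lt_zero.2 (by positivity)
  have hpos : 0 < σ ^ n / (2 * n).choose n *
      volume.real (ballBody ((n : ℝ) + 2) (covariogram K)) := by positivity
  rw [hconst, hK.isotropicConstant_eq hn]
  refine ⟨le_mul_of_one_le_right hK.pos.le
    (Real.one_le_rpow_of_pos_of_le_one_of_nonpos hpos hle hexp.le), ?_⟩
  have hinj := Real.rpow_left_inj hpos.le zero_le_one hexp.ne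
  rw [Real.one_rpow] at hinj
  -- The exponent is non-zero, so equality of the constants is equality in the volume bound, that
  -- is, conic profiles in all directions.
  rw [eq_comm, mul_eq_left₀ hK.pos.ne', hinj, heq]
  constructor
  · intro h
    obtain ⟨s, hs⟩ := exists_simplex_of_covariogram hK.convexBody hK.volume_eq_one h
    exact ⟨s, hK.equilateral hn s hs, hs⟩
  · rintro ⟨s, -, hs⟩ x hx
    exact covariogram_convexHull_affineBasis hn s.affineBasis hs hK.volume_eq_one hx
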